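/- Let $\mu$ be a probability law on $\mathbb{R}^d$, let $n\ge 1$ and let $\mathbf X_1,\dots,\mathbf X_n$ be i.i.d. with law $\mu$, the law of a random vector $\mathbf X$. Let $\mathcal A$ be a class of measurable subsets of $\mathbb{R}^d$ with finite VC dimension $V_{\mathcal A}$ (the largest cardinality of a finite set shattered by $\mathcal A$), such that the suprema over $\mathcal A$ of $|c\,\mu(A)+\sum_i e_i\mathbf 1_{\mathbf X_i\in A}|$ ($c,e_i\in\mathbb{R}$, i.i.d. samples of any size) are measurable with respect to the completed product law. Put $p=\mathbb P(\mathbf X\in\bigcup_{A\in\mathcal A}A)$, $$D_n=\sup_{A\in\mathcal A}\Big|\mathbb P(\mathbf X\in A)-\frac1n\sum_{i=1}^n\mathbf 1_{\mathbf X_i\in A}\Big|,$$ and, when $p>0$, $$\mathcal R_{n,p}=\mathbb E\sup_{A\in\mathcal A}\frac1{np}\Big|\sum_{i=1}^n\sigma_i\mathbf 1_{\mathbf X_i\in A}\Big|,$$ where the $\sigma_i$ are i.i.d. uniform on $\{-1,1\}$, independent of the $\mathbf X_i$. (1) If $p>0$ and $0<\delta<1$, then with probability at least $1-\delta$, $$\frac1p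 D_n\le 2\mathcal R_{n,p}+\frac{2}{3np}\log\frac1\delta+2\sqrt{\frac1{np}\log\frac1\delta},$$ and if moreover $\delta\ge e^{-np}$, then with probability at least $1-\delta$, $$\frac1p D_n\le 2\mathcal R_{n,p}+3\sqrt{\frac1{np}\log\frac1\delta}.$$ (2) There is an absolute constant $K$ such that, if $V_{\mathcal A}\ge1$ and $p>0$, then $\mathcal R_{n,p}\le K\sqrt{V_{\mathcal A}/(np)}$. (3) For every $\delta_0\in(0,1)$ there is a constant $C$ depending only on $\delta_0$ (not on $d,\mu,\mathcal A,n,p,\delta$) such that, if $V_{\mathcal A}\ge1$ and $0<\delta\le\delta_0$, then with probability at least $1-\delta$, $$D_n\le C\Big(\sqrt p\,\sqrt{\frac{V_{\mathcal A}}n\log\frac1\delta}+\frac1n\log\frac1\delta\Big),$$ and if moreover $\delta\ge e^{-np}$, then with probability at least $1-\delta$, $$\frac1p D_n\le C\sqrt{\frac{V_{\mathcal A}}{np}\log\frac1\delta}.$$ -/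

import Mathlib

open MeasureTheory ProbabilityTheory

/-- The class `𝒜` shatters the finite set `s`: every subset of `s` is the trace on `s` of some
member of `𝒜`. -/
def ShattersSet {E : Type*} (𝒜 : Set (Set E)) (s : Finset E) : Prop :=
  ∀ t : Set E, t ⊆ (s : Set E) → ∃ A ∈ 𝒜, (s : Set E) ∩ A = t

/-- The Vapnik-Chervonenkis dimension of `𝒜`: the supremum of the cardinalities of the finite sets
shattered by `𝒜`. The class `𝒜` is a VC class when this is finite. -/
noncomputable def vcDimension {E : Type*} (𝒜 : Set (Set E)) : ℕ∞ :=
  ⨆ (s : Finset E) (_ : ShattersSet 𝒜 s), (s.card : ℕ∞)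

/-- The indicator of `A`, evaluated at `x`, as a real number. -/
noncomputable def ind {E : Type*} (A : Set E) (x : E) : ℝ :=
  A.indicator (fun _ => (1 : ℝ)) x

/-- The measurability that is needed for suprema over a possibly uncountable class to be random
variables: the members of `𝒜` are measurable, and for an i.i.d. sample `x` of law `μ` (of any size)
the supremum over `A ∈ 𝒜` of `|c μ(A) + ∑ i, e i 1_A(x i)|` is measurable (with respect to the
completion of the product law) for all real coefficients. -/
structure IsMeasurableClass {E : Type*} [MeasurableSpace E] (μ : Measure E)
    (𝒜 : Set (Set E)) : Prop where
  measurableSet : ∀ A ∈ 𝒜, MeasurableSet A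
  aemeasurable_iSup : ∀ (m : ℕ) (c : ℝ) (e : Fin m → ℝ),
    AEMeasurable (fun x : Fin m → E => ⨆ A : 𝒜, |c * μ.real (A : Set E) + ∑ i, e i * ind A.1 (x i)|)
      (Measure.pi fun _ : Fin m => μ)

/-- The probability `p` of the union of the class. -/
noncomputable def unionProb {E : Type*} [MeasurableSpace E] (μ : Measure E)
    (𝒜 : Set (Set E)) : ℝ :=
  μ.real (⋃₀ 𝒜)

/-- The maximal deviation over `𝒜` between the law `μ` and the empirical measure of the sample
`x 0, …, x (n - 1)`. -/
noncomputable def maxDeviation {E : Type*} [MeasurableSpace E] (μ : Measure E)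
    (𝒜 : Set (Set E)) {n : ℕ} (x : Fin n → E) : ℝ :=
  ⨆ A : 𝒜, |μ.real (A : Set E) - 1 / (n : ℝ) * ∑ i, ind A.1 (x i)|

/-- The law of a random sign: mass `1/2` at `1` and at `-1`. -/
noncomputable def rademacherLaw : Measure ℝ :=
  (2⁻¹ : ENNReal) • Measure.dirac 1 + (2⁻¹ : ENNReal) • Measure.dirac (-1)

/-- The relative Rademacher average
`E sup_{A ∈ 𝒜} (1 / (n p)) |∑ i, σ i 1_{X i ∈ A}|`, where `X 0, …, X (n - 1)` are i.i.d. of law `μ`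
and the `σ i` are i.i.d. random signs, independent of the `X i`. -/
noncomputable def relRademacher {E : Type*} [MeasurableSpace E] (μ : Measure E)
    (𝒜 : Set (Set E)) (n : ℕ) : ℝ :=
  ∫ z : (Fin n → E) × (Fin n → ℝ),
    ⨆ A : 𝒜, 1 / ((n : ℝ) * unionProb μ 𝒜) * |∑ i, z.2 i * ind A.1 (z.1 i)|
    ∂((Measure.pi fun _ : Fin n => μ).prod (Measure.pi fun _ : Fin n => rademacherLaw))

/-! Write `U` for the union of the class, `p` for its probability, and consider `n * D_n` as a
function of the sample. Three ingredients are combined.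

Concentration. Replacing one sample point `x i` by `z` changes `n * D_n` by at most `1`, and by at
most `1_U(x i) + 1_U(z)`. Integrating out the coordinates one at a time gives increments bounded by
`1` whose second moment is at most `2p`, so a Bernstein inequality with variance of order `n * p`,
not `n`, holds: `integral_exp_sub_integral_le`, `measureReal_deviation_le`.

Symmetrization. With a ghost sample and an exchange of the two copies at selected indices, the mean
of `n * D_n` is at most twice that of the signed supremum, for every fixed sign vector:
`integral_supSum_le_two_mul`. Averaging over signs produces the Rademacher average, and part (1)
follows.

Chaining. On a fixed sample the class is a finite family of index sets, all contained in the set `T`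
of indices whose points lie in `U`. A random subsample separates the members of an `ε`-separated
subfamily, so Sauer-Shelah bounds its logarithmic size by `V * log (1 / ε)` up to constants:
`log_card_le_of_separated`. Chaining over radii `|T| / 16 ^ j` gives `10 * √(V * |T|)` without a
logarithmic factor: `signAvg_maxSignSum_traceFamily_le`. Since `|T|` has mean `n * p`, this is part
(2).

Part (3) combines the two: as `δ ≤ δ₀`, `log (1 / δ)` is bounded below, so the Rademacher term is
absorbed into the deviation term. -/

/-! ### Traces of a class of sets on a finite sample -/

/-- The sets of indices cut out by the members of `𝒜` on the finite sample `x`. -/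
noncomputable def traceFamily {E ι : Type*} [Fintype ι] (𝒜 : Set (Set E)) (x : ι → E) :
    Finset (Finset ι) :=
  (Set.toFinite {F : Finset ι | ∃ A ∈ 𝒜, ∀ i, i ∈ F ↔ x i ∈ A}).toFinset

theorem mem_traceFamily {E ι : Type*} [Fintype ι] {𝒜 : Set (Set E)} {x : ι → E} {F : Finset ι} :
    F ∈ traceFamily 𝒜 x ↔ ∃ A ∈ 𝒜, ∀ i, i ∈ F ↔ x i ∈ A := by
  simp [traceFamily]

/-- Equal sample points cannot be separated by a set, so the sample is injective on a shattered set
of indices, and the image of that set is shattered by `𝒜` with the same cardinality. -/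
theorem vcDim_traceFamily_le {E ι : Type*} [Fintype ι] [DecidableEq ι] {𝒜 : Set (Set E)} {V : ℕ}
    (hV : vcDimension 𝒜 ≤ V) (x : ι → E) : (traceFamily 𝒜 x).vcDim ≤ V := by
  classical
  refine Finset.sup_le fun s hs => ?_
  rw [Finset.mem_shatterer] at hs
  have hinj : Set.InjOn x (s : Set ι) := by
    intro i hi j hj hij
    obtain ⟨u, hu, hsu⟩ := hs (t := {i}) (by simpa using hi)
    obtain ⟨A, -, hA⟩ := mem_traceFamily.1 hu
    have hiu : i ∈ s ∩ u := by simp [hsu]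
    have hju : j ∈ s ∩ u := by
      refine Finset.mem_inter.2 ⟨hj, (hA j).2 ?_⟩
      rw [← hij]
      exact (hA i).1 (Finset.mem_inter.1 hiu).2
    rw [hsu, Finset.mem_singleton] at hju
    exact hju.symm
  have hsh : ShattersSet 𝒜 (s.image x) := by
    intro t ht
    obtain ⟨u, hu, hsu⟩ := hs (t := s.filter fun i => x i ∈ t) (Finset.filter_subset _ _)
    obtain ⟨A, hA𝒜, hA⟩ := mem_traceFamily.1 hu
    refine ⟨A, hA𝒜, ?_⟩
    have key : ∀ i ∈ s, (x i ∈ A ↔ x i ∈ t) := by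
      intro i hi
      have := congrArg (fun F => i ∈ F) hsu
      simpa [hi, hA] using this
    ext y
    constructor
    · rintro ⟨hy, hyA⟩
      obtain ⟨i, hi, rfl⟩ := Finset.mem_image.1 (Finset.mem_coe.1 hy)
      exact (key i hi).1 hyA
    · intro hy
      refine ⟨ht hy, ?_⟩
      obtain ⟨i, hi, rfl⟩ := Finset.mem_image.1 (Finset.mem_coe.1 (ht hy))
      exact (key i hi).2 hy
  have h1 : ((s.image x).card : ℕ∞) ≤ vcDimension 𝒜 :=
    le_iSup₂ (f := fun (s : Finset E) (_ : ShattersSet 𝒜 s) => (s.card : ℕ∞)) _ hsh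
  rw [Finset.card_image_of_injOn hinj] at h1
  exact_mod_cast h1.trans hV

/-- As `t ≤ 1`, each `t ^ V` may be replaced by `t ^ k` with `k ≤ V`; completing the sum gives `(1 +
t) ^ m ≤ exp (t * m)`. Keeping `t` free avoids any comparison of `m` with `V`. -/
theorem sum_Iic_choose_mul_pow_le_exp (V m : ℕ) {t : ℝ} (ht : 0 < t) (ht1 : t ≤ 1) :
    (∑ k ∈ Finset.Iic V, (m.choose k : ℝ)) * t ^ V ≤ Real.exp (t * m) := by
  have h1 : (∑ k ∈ Finset.Iic V, (m.choose k : ℝ)) * t ^ V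
      ≤ ∑ k ∈ Finset.Iic V, (m.choose k : ℝ) * t ^ k := by
    rw [Finset.sum_mul]
    refine Finset.sum_le_sum fun k hk => ?_
    exact mul_le_mul_of_nonneg_left
      (pow_le_pow_of_le_one ht.le ht1 (Finset.mem_Iic.1 hk)) (by positivity)
  have h2 : ∑ k ∈ Finset.Iic V, (m.choose k : ℝ) * t ^ k
      ≤ ∑ k ∈ Finset.range (m + V + 1), (m.choose k : ℝ) * t ^ k := by
    refine Finset.sum_le_sum_of_subset_of_nonneg ?_ fun k _ _ => by positivity
    intro k hk
    rw [Finset.mem_Iic] at hk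
    rw [Finset.mem_range]
    omega
  have h3 : ∑ k ∈ Finset.range (m + V + 1), (m.choose k : ℝ) * t ^ k = (t + 1) ^ m := by
    rw [add_pow]
    symm
    refine (Finset.sum_congr rfl fun k _ => by ring).trans
      (Finset.sum_subset (f := fun k => (m.choose k : ℝ) * t ^ k) ?_ fun k _ hk => ?_)
    · intro k hk
      rw [Finset.mem_range] at hk ⊢
      omega
    · rw [Finset.mem_range, not_lt] at hk
      rw [Nat.choose_eq_zero_of_lt (by omega)]
      simp
  have h4 : (t + 1) ^ m ≤ Real.exp (t * m) := by
    rw [mul_comm t, Real.exp_nat_mul]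
    exact pow_le_pow_left₀ (by positivity) (Real.add_one_le_exp t) m
  linarith

/-- The Sauer-Shelah bound for the number of traces on a sample of size `m`. -/
theorem card_traceFamily_mul_pow_le {E : Type*} {𝒜 : Set (Set E)} {V : ℕ}
    (hV : vcDimension 𝒜 ≤ V) {m : ℕ} (x : Fin m → E) {t : ℝ} (ht : 0 < t) (ht1 : t ≤ 1) :
    ((traceFamily 𝒜 x).card : ℝ) * t ^ V ≤ Real.exp (t * m) := by
  refine le_trans ?_ (sum_Iic_choose_mul_pow_le_exp V m ht ht1)
  refine mul_le_mul_of_nonneg_right ?_ (by positivity)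
  have h1 := (Finset.card_le_card_shatterer (traceFamily 𝒜 x)).trans
    Finset.card_shatterer_le_sum_vcDim
  rw [Fintype.card_fin] at h1
  have h2 : ∑ k ∈ Finset.Iic (traceFamily 𝒜 x).vcDim, m.choose k
      ≤ ∑ k ∈ Finset.Iic V, m.choose k :=
    Finset.sum_le_sum_of_subset (Finset.Iic_subset_Iic.2 (vcDim_traceFamily_le hV x))
  exact_mod_cast h1.trans h2

/-- The packing bound: a family of traces whose pairwise distances exceed the proportion `ε` of the
sample has at most polynomially many members in `1 / ε`. -/
theorem log_card_le_of_separated {E ι : Type*} [Fintype ι] [DecidableEq ι] {𝒜 : Set (Set E)}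
    {V : ℕ} (hV : vcDimension 𝒜 ≤ V) (x : ι → E) (T : Finset ι) {𝒢 : Finset (Finset ι)}
    (h𝒢 : 𝒢 ⊆ traceFamily 𝒜 x) (hT : ∀ F ∈ 𝒢, F ⊆ T) {ε : ℝ} (hε : 0 < ε) (hε1 : ε ≤ 1)
    (hsep : ∀ F ∈ 𝒢, ∀ G ∈ 𝒢, F ≠ G → ε * T.card ≤ ((symmDiff F G).card : ℝ)) :
    Real.log 𝒢.card ≤ 2 * V * Real.log (4 / ε) + 1 / 2 := by
  have hlog4 : 0 ≤ Real.log (4 / ε) := Real.log_nonneg (by rw [le_div_iff₀ hε]; linarith)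
  rcases Nat.lt_or_ge 1 𝒢.card with hM | hM
  swap
  · have : Real.log 𝒢.card ≤ 0 := Real.log_nonpos (by positivity) (by exact_mod_cast hM)
    have : 0 ≤ 2 * V * Real.log (4 / ε) := by positivity
    linarith
  have hTne : 0 < T.card := by
    obtain ⟨F, hF, G, hG, hFG⟩ := Finset.one_lt_card.1 hM
    rw [Finset.card_pos]
    by_contra h
    rw [Finset.not_nonempty_iff_eq_empty] at h
    exact hFG ((Finset.subset_empty.1 (h ▸ hT F hF)).trans
      (Finset.subset_empty.1 (h ▸ hT G hG)).symm)
  set M : ℝ := (𝒢.card : ℝ) with hMdef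
  have hM1 : 1 < M := by rw [hMdef]; exact_mod_cast hM
  have hlogM : 0 ≤ Real.log M := Real.log_nonneg hM1.le
  set k : ℕ := ⌈2 * Real.log M / ε⌉₊ with hk
  have hk1 : 2 * Real.log M / ε ≤ k := Nat.le_ceil _
  have hk2 : (k : ℝ) < 2 * Real.log M / ε + 1 := Nat.ceil_lt_add_one (by positivity)
  -- Probabilistic method by counting: `k` uniform draws from `T` miss a given symmetric difference
  -- with proportion at most `exp (-ε * k) ≤ M⁻²`, and there are only `M² - M` ordered pairs, so
  -- some draw meets them all.
  obtain ⟨f, hf⟩ : ∃ f : Fin k → ι, ∀ F ∈ 𝒢, ∀ G ∈ 𝒢, F ≠ G → ∃ j, f j ∈ symmDiff F G := by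
    by_contra! hcon
    have hsub : Fintype.piFinset (fun _ : Fin k => T) ⊆
        𝒢.offDiag.biUnion fun q => Fintype.piFinset fun _ : Fin k => T \ symmDiff q.1 q.2 := by
      intro f hf
      obtain ⟨F, hF, G, hG, hFG, hj⟩ := hcon f
      rw [Finset.mem_biUnion]
      refine ⟨(F, G), Finset.mem_offDiag.2 ⟨hF, hG, hFG⟩, ?_⟩
      rw [Fintype.mem_piFinset] at hf ⊢
      exact fun j => Finset.mem_sdiff.2 ⟨hf j, hj j⟩
    have hcard := (Finset.card_le_card hsub).trans Finset.card_biUnion_le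
    rw [Fintype.card_piFinset_const] at hcard
    have hcard' : (T.card : ℝ) ^ k ≤
        ∑ q ∈ 𝒢.offDiag, (((T \ symmDiff q.1 q.2).card : ℝ)) ^ k := by
      have := hcard
      simp only [Fintype.card_piFinset_const] at this
      exact_mod_cast this
    have hterm : ∀ q ∈ 𝒢.offDiag, (((T \ symmDiff q.1 q.2).card : ℝ)) ^ k ≤
        (T.card : ℝ) ^ k * (M ^ 2)⁻¹ := by
      rintro ⟨F, G⟩ hq
      obtain ⟨hF, hG, hFG⟩ := Finset.mem_offDiag.1 hq
      have hs : symmDiff F G ⊆ T := by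
        intro i hi
        rcases Finset.mem_symmDiff.1 hi with h | h
        · exact hT F hF h.1
        · exact hT G hG h.1
      have h1 : (((T \ symmDiff F G).card : ℝ)) ≤ T.card * Real.exp (-ε) := by
        rw [Finset.card_sdiff_of_subset hs, Nat.cast_sub (Finset.card_le_card hs)]
        have h2 := hsep F hF G hG hFG
        have h3 := Real.add_one_le_exp (-ε)
        have h4 : (T.card : ℝ) * (-ε + 1) ≤ T.card * Real.exp (-ε) :=
          mul_le_mul_of_nonneg_left h3 (by positivity)
        linarith
      refine (pow_le_pow_left₀ (by positivity) h1 k).trans ?_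
      rw [mul_pow]
      refine mul_le_mul_of_nonneg_left ?_ (by positivity)
      rw [← Real.exp_nat_mul, ← Real.exp_log (show (0 : ℝ) < (M ^ 2)⁻¹ by positivity),
        Real.log_inv, Real.log_pow, Real.exp_le_exp]
      rw [div_le_iff₀ hε] at hk1
      push_cast
      linarith
    have hsum := hcard'.trans (Finset.sum_le_sum hterm)
    rw [Finset.sum_const, Finset.offDiag_card, nsmul_eq_mul,
      Nat.cast_sub (Nat.le_mul_self _), Nat.cast_mul, ← hMdef] at hsum
    have hTk : (0 : ℝ) < (T.card : ℝ) ^ k := by positivity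
    have : (M * M - M) * ((T.card : ℝ) ^ k * (M ^ 2)⁻¹) =
        (T.card : ℝ) ^ k - (T.card : ℝ) ^ k * M⁻¹ := by
      field_simp
    rw [this] at hsum
    have : 0 < (T.card : ℝ) ^ k * M⁻¹ := by positivity
    linarith
  have hMle : M ≤ ((traceFamily 𝒜 (x ∘ f)).card : ℝ) := by
    rw [hMdef]
    norm_cast
    refine Finset.card_le_card_of_injOn (fun F => Finset.univ.filter fun j => f j ∈ F) ?_ ?_
    · intro F hF
      obtain ⟨A, hA, hFA⟩ := mem_traceFamily.1 (h𝒢 hF)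
      refine Finset.mem_coe.2 (mem_traceFamily.2 ⟨A, hA, fun j => ?_⟩)
      simp [hFA]
    · intro F hF G hG hFG
      by_contra hne
      obtain ⟨j, hj⟩ := hf F hF G hG hne
      have := congrArg (fun S => j ∈ S) hFG
      simp only [Finset.mem_filter, Finset.mem_univ, true_and, eq_iff_iff] at this
      rw [Finset.mem_symmDiff] at hj
      tauto
  -- With `t = ε / 4` the Sauer-Shelah exponent `t * k` is about `log M / 2`, which is absorbed by
  -- the left-hand side; this is the source of the factor `2`.
  have ht : 0 < ε / 4 := by positivity
  have hS := card_traceFamily_mul_pow_le hV (x ∘ f) ht (by linarith)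
  have hS' : M * (ε / 4) ^ V ≤ Real.exp (ε / 4 * k) :=
    (mul_le_mul_of_nonneg_right hMle (by positivity)).trans hS
  have hS'' := Real.log_le_log (by positivity) hS'
  rw [Real.log_exp, Real.log_mul (by positivity) (by positivity), Real.log_pow] at hS''
  have hinv : Real.log (ε / 4) = -Real.log (4 / ε) := by rw [← Real.log_inv, inv_div]
  rw [hinv] at hS''
  have hk3 : ε / 4 * k ≤ Real.log M / 2 + 1 / 4 := by
    have := mul_le_mul_of_nonneg_left hk2.le ht.le
    have e : ε / 4 * (2 * Real.log M / ε + 1) = Real.log M / 2 + ε / 4 := by field_simp; ring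
    linarith
  linarith

/-! ### Sign averages and chaining -/

/-- The real sign attached to a Boolean. -/
def boolSign (b : Bool) : ℝ := cond b 1 (-1)

/-- The average of a function over all choices of signs. -/
noncomputable def signAvg {ι : Type*} [Fintype ι] [DecidableEq ι] (Φ : (ι → Bool) → ℝ) : ℝ :=
  ((2 : ℝ) ^ Fintype.card ι)⁻¹ * ∑ s, Φ s

section SignAvg

variable {ι : Type*} [Fintype ι] [DecidableEq ι]

theorem signAvg_mono {Φ Ψ : (ι → Bool) → ℝ} (h : ∀ s, Φ s ≤ Ψ s) : signAvg Φ ≤ signAvg Ψ :=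
  mul_le_mul_of_nonneg_left (Finset.sum_le_sum fun s _ => h s) (by positivity)

theorem signAvg_add (Φ Ψ : (ι → Bool) → ℝ) :
    signAvg (fun s => Φ s + Ψ s) = signAvg Φ + signAvg Ψ := by
  simp only [signAvg, Finset.sum_add_distrib, mul_add]

theorem signAvg_const_mul (c : ℝ) (Φ : (ι → Bool) → ℝ) :
    signAvg (fun s => c * Φ s) = c * signAvg Φ := by
  simp only [signAvg, ← Finset.mul_sum]
  ring

theorem signAvg_const (c : ℝ) : signAvg (fun _ : ι → Bool => c) = c := by
  simp [signAvg]

theorem signAvg_sum {β : Type*} (S : Finset β) (Φ : β → (ι → Bool) → ℝ) :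
    signAvg (fun s => ∑ b ∈ S, Φ b s) = ∑ b ∈ S, signAvg (Φ b) := by
  simp only [signAvg]
  rw [Finset.sum_comm, Finset.mul_sum]

/-- Independence turns the average into a product of `cosh (a i)`, each at most `exp (a i ^ 2 / 2)`.
-/
theorem signAvg_exp_le (a : ι → ℝ) {r : ℝ} (h : ∑ i, a i ^ 2 ≤ r) :
    signAvg (fun s => Real.exp (∑ i, a i * boolSign (s i))) ≤ Real.exp (r / 2) := by
  have h1 : signAvg (fun s => Real.exp (∑ i, a i * boolSign (s i))) =
      ∏ i, Real.cosh (a i) := by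
    simp only [signAvg, Real.exp_sum]
    rw [← Fintype.prod_sum (fun i b => Real.exp (a i * boolSign b))]
    rw [← Finset.card_univ, ← Finset.prod_const, ← Finset.prod_inv_distrib,
      ← Finset.prod_mul_distrib]
    refine Finset.prod_congr rfl fun i _ => ?_
    rw [Fintype.sum_bool, Real.cosh_eq]
    simp only [boolSign, cond_true, cond_false]
    rw [mul_one, mul_neg, mul_one]
    ring
  rw [h1]
  refine (Finset.prod_le_prod (fun i _ => (Real.cosh_pos _).le)
    fun i _ => Real.cosh_le_exp_half_sq (a i)).trans ?_
  rw [← Real.exp_sum, Real.exp_le_exp, ← Finset.sum_div]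
  linarith

/-- The maximal inequality for finitely many sign sums. -/
theorem signAvg_iSup_le {β : Type*} [Fintype β] [Nonempty β] (a : β → ι → ℝ) {r l : ℝ}
    (hl : 0 < l) (h : ∀ b, ∑ i, a b i ^ 2 ≤ r) :
    signAvg (fun s => ⨆ b, |∑ i, a b i * boolSign (s i)|) ≤
      Real.log (2 * Fintype.card β) / l + l * r / 2 := by
  set B : ℝ := 2 * Fintype.card β * Real.exp (l ^ 2 * r / 2) with hB
  have hcard : (0 : ℝ) < Fintype.card β := by exact_mod_cast Fintype.card_pos
  have hBpos : 0 < B := by positivity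
  -- The tangent of the logarithm at `B` replaces Jensen's inequality; `B` is the bound for the
  -- averaged sum of exponentials, both signs included.
  have hlin : ∀ y : ℝ, y ≤ Real.log B - 1 + B⁻¹ * Real.exp y := by
    intro y
    have h1 := Real.add_one_le_exp (y - Real.log B)
    rw [Real.exp_sub, Real.exp_log hBpos, div_eq_inv_mul] at h1
    linarith
  have hpt : ∀ s : ι → Bool, l * (⨆ b, |∑ i, a b i * boolSign (s i)|) ≤
      Real.log B - 1 + B⁻¹ * ∑ b, (Real.exp (∑ i, (l * a b i) * boolSign (s i)) +
        Real.exp (∑ i, (-l * a b i) * boolSign (s i))) := by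
    intro s
    obtain ⟨b, hb⟩ := exists_eq_ciSup_of_finite (f := fun b => |∑ i, a b i * boolSign (s i)|)
    rw [← hb]
    refine (hlin _).trans ?_
    gcongr
    set q := ∑ i, a b i * boolSign (s i) with hq
    have e1 : ∑ i, (l * a b i) * boolSign (s i) = l * q := by
      rw [hq, Finset.mul_sum]
      exact Finset.sum_congr rfl fun i _ => by ring
    have e2 : ∑ i, (-l * a b i) * boolSign (s i) = l * (-q) := by
      rw [hq, ← Finset.sum_neg_distrib, Finset.mul_sum]
      exact Finset.sum_congr rfl fun i _ => by ring
    refine le_trans ?_ (Finset.single_le_sum (f := fun b =>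
      Real.exp (∑ i, (l * a b i) * boolSign (s i)) +
        Real.exp (∑ i, (-l * a b i) * boolSign (s i))) (fun b _ => by positivity)
        (Finset.mem_univ b))
    rw [e1, e2]
    rcases abs_cases q with ⟨h1, -⟩ | ⟨h1, -⟩ <;> rw [h1]
    · exact le_add_of_nonneg_right (Real.exp_pos _).le
    · exact le_add_of_nonneg_left (Real.exp_pos _).le
  have hexp : ∀ c : ℝ, c ^ 2 = l ^ 2 → ∀ b,
      signAvg (fun s => Real.exp (∑ i, (c * a b i) * boolSign (s i))) ≤
        Real.exp (l ^ 2 * r / 2) := by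
    intro c hc b
    refine signAvg_exp_le _ ?_
    simp only [mul_pow]
    rw [← Finset.mul_sum, hc]
    exact mul_le_mul_of_nonneg_left (h b) (by positivity)
  have havg := signAvg_mono hpt
  rw [signAvg_const_mul, signAvg_add, signAvg_const, signAvg_const_mul, signAvg_sum] at havg
  simp only [signAvg_add] at havg
  have hS : ∑ b, (signAvg (fun s => Real.exp (∑ i, (l * a b i) * boolSign (s i))) +
      signAvg (fun s => Real.exp (∑ i, (-l * a b i) * boolSign (s i)))) ≤ B := by
    refine (Finset.sum_le_sum fun b _ =>
      add_le_add (hexp l rfl b) (hexp (-l) (by ring) b)).trans ?_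
    rw [Finset.sum_const, Finset.card_univ, nsmul_eq_mul, hB]
    linarith
  have hS2 := mul_le_mul_of_nonneg_left hS (inv_nonneg.2 hBpos.le)
  rw [inv_mul_cancel₀ hBpos.ne'] at hS2
  have hlogB : Real.log B = Real.log (2 * Fintype.card β) + l ^ 2 * r / 2 := by
    rw [hB, Real.log_mul (by positivity) (by positivity), Real.log_exp]
  have hfin : l * signAvg (fun s => ⨆ b, |∑ i, a b i * boolSign (s i)|) ≤
      Real.log (2 * Fintype.card β) + l ^ 2 * r / 2 := by linarith
  have e : Real.log (2 * Fintype.card β) / l + l * r / 2 =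
      (Real.log (2 * Fintype.card β) + l ^ 2 * r / 2) / l := by field_simp
  rw [e, le_div_iff₀ hl]
  linarith

/-- The largest absolute value of the sign sums over the members of a finite family of index
sets. -/
noncomputable def maxSignSum {ι : Type*} (𝒢 : Finset (Finset ι)) (s : ι → Bool) : ℝ :=
  ⨆ F : 𝒢, |∑ i ∈ F.1, boolSign (s i)|

theorem abs_le_maxSignSum {ι : Type*} {𝒢 : Finset (Finset ι)} {F : Finset ι} (hF : F ∈ 𝒢)
    (s : ι → Bool) :
    |∑ i ∈ F, boolSign (s i)| ≤ maxSignSum 𝒢 s :=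
  le_ciSup (f := fun F : 𝒢 => |∑ i ∈ F.1, boolSign (s i)|) (Set.finite_range _).bddAbove ⟨F, hF⟩

/-- A separated subfamily of largest cardinality is a net, since an uncovered member could be added.
Distances are multiplied by `c` so that the radius `N / c` stays within the integers. -/
theorem exists_maximal_separated {𝒯 : Finset (Finset ι)} {c : ℕ} (N : ℕ) :
    ∃ 𝒢 ⊆ 𝒯, (∀ F ∈ 𝒢, ∀ G ∈ 𝒢, F ≠ G → N < (symmDiff F G).card * c) ∧
      ∀ F ∈ 𝒯, ∃ G ∈ 𝒢, (symmDiff F G).card * c ≤ N := by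
  classical
  obtain ⟨𝒢, h𝒢, hmax⟩ := Finset.exists_max_image
    (𝒯.powerset.filter fun 𝒢 => ∀ F ∈ 𝒢, ∀ G ∈ 𝒢, F ≠ G → N < (symmDiff F G).card * c)
    Finset.card ⟨∅, by simp⟩
  rw [Finset.mem_filter, Finset.mem_powerset] at h𝒢
  refine ⟨𝒢, h𝒢.1, h𝒢.2, fun F hF => ?_⟩
  by_contra! hcon
  have hF𝒢 : F ∉ 𝒢 := fun h => by simpa using hcon F h
  have := hmax (insert F 𝒢) (by
    rw [Finset.mem_filter, Finset.mem_powerset]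
    refine ⟨Finset.insert_subset hF h𝒢.1, ?_⟩
    intro G hG H hH hne
    rcases Finset.mem_insert.1 hG with hG' | hG' <;>
      rcases Finset.mem_insert.1 hH with hH' | hH'
    · exact absurd (hG'.trans hH'.symm) hne
    · exact hG' ▸ hcon H hH'
    · rw [symmDiff_comm]
      exact hH' ▸ hcon G hG'
    · exact h𝒢.2 G hG' H hH' hne)
  rw [Finset.card_insert_of_notMem hF𝒢] at this
  omega

theorem sum_sq_indicator_sub (G H : Finset ι) :
    ∑ i, ((if i ∈ G then (1 : ℝ) else 0) - if i ∈ H then 1 else 0) ^ 2 =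
      ((symmDiff G H).card : ℝ) := by
  rw [Finset.card_eq_sum_ones, Nat.cast_sum, ← Finset.sum_subset (Finset.subset_univ (symmDiff G H))]
  · refine Finset.sum_congr rfl fun i hi => ?_
    rw [Finset.mem_symmDiff] at hi
    rcases hi with h | h <;> simp [h.1, h.2]
  · intro i _ hi
    rw [Finset.mem_symmDiff] at hi
    by_cases hG : i ∈ G <;> by_cases hH : i ∈ H <;> simp_all

theorem sum_indicator_sub_mul (G H : Finset ι) (s : ι → Bool) :
    ∑ i, ((if i ∈ G then (1 : ℝ) else 0) - if i ∈ H then 1 else 0) * boolSign (s i) =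
      ∑ i ∈ G, boolSign (s i) - ∑ i ∈ H, boolSign (s i) := by
  simp [sub_mul, Finset.sum_sub_distrib]

/-- Turns the packing bound at scale `ε = 16⁻⁽ʲ⁺¹⁾`, which is linear in `j`, into the crude entropy
bound `10 * V * 4 ^ j`; its square root grows like `2 ^ j`, slower than the radii `4 ^ (-j)` decay.
-/
theorem log_two_mul_le_chain {V : ℕ} (hV : 1 ≤ V) (j : ℕ) {M : ℝ} (hM : 0 < M)
    (h : Real.log M ≤ 2 * V * Real.log (4 / ((16 : ℝ) ^ (j + 1))⁻¹) + 1 / 2) :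
    Real.log (2 * M) ≤ 10 * V * 4 ^ j := by
  have e : (4 : ℝ) / ((16 : ℝ) ^ (j + 1))⁻¹ = 2 ^ (4 * j + 6) := by
    rw [div_inv_eq_mul, pow_add 2 (4 * j), pow_mul, pow_succ]
    norm_num
    ring
  rw [e, Real.log_pow] at h
  rw [Real.log_mul (by norm_num) hM.ne']
  have h2 := Real.log_two_lt_d9
  have h2' := Real.log_two_gt_d9
  have hV' : (1 : ℝ) ≤ V := by exact_mod_cast hV
  have hj : (j : ℝ) + 1 ≤ 4 ^ j := by
    have : j < 4 ^ j := Nat.lt_pow_self (by norm_num)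
    exact_mod_cast this
  push_cast at h
  have h3 : 2 * (V : ℝ) * ((4 * j + 6) * Real.log 2) ≤ 2 * V * ((4 * j + 6) * 0.7) := by
    gcongr
    linarith
  have h4 : (10 : ℝ) * V * (j + 1) ≤ 10 * V * 4 ^ j := by gcongr
  have h5 : (0 : ℝ) ≤ V * j := by positivity
  nlinarith

/-- One link of the chain. -/
theorem signAvg_maxSignSum_step {V N j : ℕ} (hV : 1 ≤ V) (hN : 0 < N)
    {𝒢 ℋ : Finset (Finset ι)} (hℋ : ℋ.Nonempty)
    (hlog : Real.log (2 * ℋ.card) ≤ 10 * V * 4 ^ j)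
    (hnear : ∀ F ∈ ℋ, ∃ G ∈ 𝒢, (symmDiff F G).card * 16 ^ j ≤ N) :
    signAvg (maxSignSum ℋ) ≤ signAvg (maxSignSum 𝒢) +
      3 / 2 * √(10 * V * N) * (1 / 2) ^ j := by
  choose! π hπ𝒢 hπ using hnear
  have : Nonempty ℋ := hℋ.to_subtype
  set a : ℋ → ι → ℝ := fun F i => (if i ∈ F.1 then (1 : ℝ) else 0) - if i ∈ π F.1 then 1 else 0
  have h1 : ∀ s, maxSignSum ℋ s ≤ maxSignSum 𝒢 s + ⨆ F : ℋ, |∑ i, a F i * boolSign (s i)| := by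
    intro s
    refine ciSup_le fun F => ?_
    have h2 := abs_le_maxSignSum (hπ𝒢 F.1 F.2) s
    have h3 := le_ciSup (f := fun F : ℋ => |∑ i, a F i * boolSign (s i)|)
      (Set.finite_range _).bddAbove F
    simp only [a, sum_indicator_sub_mul] at h3 ⊢
    have h4 := abs_sub_abs_le_abs_sub (∑ i ∈ F.1, boolSign (s i)) (∑ i ∈ π F.1, boolSign (s i))
    linarith
  set D : ℝ := √(10 * V * N) with hD
  have hV' : (0 : ℝ) < V := by exact_mod_cast hV
  have hN' : (0 : ℝ) < N := by exact_mod_cast hN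
  have hDpos : 0 < D := Real.sqrt_pos.2 (by positivity)
  have hDsq : D * D = 10 * V * N := Real.mul_self_sqrt (by positivity)
  -- This `l` makes the entropy term equal to `D / 2 ^ j` and the variance term half of it, whence
  -- the factor `3 / 2`.
  have h2 := signAvg_iSup_le a (r := N / 16 ^ j) (l := D * 8 ^ j / N) (by positivity) fun F => by
    simp only [a, sum_sq_indicator_sub]
    rw [le_div_iff₀ (by positivity)]
    exact_mod_cast hπ F.1 F.2
  rw [Fintype.card_coe] at h2
  have h3 : Real.log (2 * ℋ.card) / (D * 8 ^ j / N) ≤ D * (1 / 2) ^ j := by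
    rw [div_le_iff₀ (by positivity)]
    refine hlog.trans (le_of_eq ?_)
    have : D * (1 / 2) ^ j * (D * 8 ^ j / N) = D * D * ((1 / 2) ^ j * 8 ^ j) / N := by ring
    rw [this, hDsq, ← mul_pow]
    norm_num
    field_simp
  have h4 : D * 8 ^ j / N * (N / 16 ^ j) / 2 = 1 / 2 * D * (1 / 2) ^ j := by
    have : (16 : ℝ) ^ j = 8 ^ j * 2 ^ j := by rw [← mul_pow]; norm_num
    rw [this, one_div_pow]
    field_simp
  have h5 := signAvg_mono h1
  rw [signAvg_add] at h5
  rw [h4] at h2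
  linarith

/-- The chaining bound: the sign average of a class of VC dimension `V` on a finite sample, of which
at most `T` points lie in the union of the class. -/
theorem signAvg_maxSignSum_traceFamily_le {E : Type*} {𝒜 : Set (Set E)} {V : ℕ}
    (hV : vcDimension 𝒜 ≤ V) (hV1 : 1 ≤ V) (x : ι → E) (T : Finset ι)
    (hT : ∀ F ∈ traceFamily 𝒜 x, F ⊆ T) :
    signAvg (maxSignSum (traceFamily 𝒜 x)) ≤ 10 * √(V * T.card) := by
  set 𝒯 := traceFamily 𝒜 x with h𝒯
  rcases Finset.eq_empty_or_nonempty 𝒯 with h0 | hne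
  · rw [h0]
    have : maxSignSum (∅ : Finset (Finset ι)) = fun _ => 0 := by
      funext s
      simp [maxSignSum]
    rw [this, signAvg_const]
    positivity
  rcases Nat.eq_zero_or_pos T.card with hN | hN
  · have hT0 : T = ∅ := Finset.card_eq_zero.1 hN
    have : ∀ s, maxSignSum 𝒯 s ≤ 0 := by
      intro s
      refine Real.iSup_le (fun F => ?_) le_rfl
      have hF0 : F.1 = ∅ := Finset.subset_empty.1 (hT0 ▸ hT F.1 F.2)
      rw [hF0]
      simp
    refine (signAvg_mono this).trans ?_
    rw [signAvg_const]
    positivity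
  set N := T.card
  -- The chain starts at the empty set, whose sign sum vanishes and which is within `N` of every
  -- trace. That set need not be a trace, so the inclusion in `𝒯` is required only for `j ≠ 0`. The
  -- links form a geometric series with total `3 * √(10 * V * N)`.
  have key : ∀ j : ℕ, ∃ 𝒢 : Finset (Finset ι),
      (∀ F ∈ 𝒯, ∃ G ∈ 𝒢, (symmDiff F G).card * 16 ^ j ≤ N) ∧
      (j ≠ 0 → 𝒢 ⊆ 𝒯) ∧
      signAvg (maxSignSum 𝒢) ≤ 3 * √(10 * V * N) * (1 - (1 / 2) ^ j) := by
    intro j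
    induction j with
    | zero =>
      refine ⟨{∅}, fun F hF => ⟨∅, by simp, ?_⟩, by simp, ?_⟩
      · simpa [symmDiff] using Finset.card_le_card (hT F hF)
      · have : maxSignSum ({∅} : Finset (Finset ι)) = fun _ => 0 := by
          funext s
          simp [maxSignSum]
        rw [this, signAvg_const]
        simp
    | succ j ih =>
      obtain ⟨𝒢, hcov, -, havg⟩ := ih
      obtain ⟨ℋ, hℋ, hsep, hcov'⟩ := exists_maximal_separated (𝒯 := 𝒯) (c := 16 ^ (j + 1)) N
      refine ⟨ℋ, hcov', fun _ => hℋ, ?_⟩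
      have hℋne : ℋ.Nonempty := by
        obtain ⟨F, hF⟩ := hne
        obtain ⟨G, hG, -⟩ := hcov' F hF
        exact ⟨G, hG⟩
      have hp := log_card_le_of_separated hV x T (𝒢 := ℋ) hℋ (fun F hF => hT F (hℋ hF))
        (ε := ((16 : ℝ) ^ (j + 1))⁻¹) (by positivity)
        (inv_le_one_of_one_le₀ (one_le_pow₀ (by norm_num))) (fun F hF G hG hFG => by
          rw [inv_mul_le_iff₀ (by positivity), mul_comm]
          exact_mod_cast (hsep F hF G hG hFG).le)
      have hlog := log_two_mul_le_chain hV1 j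
        (by exact_mod_cast Finset.card_pos.2 hℋne) hp
      have hstep := signAvg_maxSignSum_step hV1 hN hℋne hlog fun F hF => hcov F (hℋ hF)
      rw [pow_succ]
      linarith
  -- At this level the radius is below one, so the net is the whole family.
  obtain ⟨𝒢, hcov, h𝒢, havg⟩ := key (N + 1)
  have h𝒯𝒢 : 𝒯 ⊆ 𝒢 := by
    intro F hF
    obtain ⟨G, hG, hFG⟩ := hcov F hF
    have h16 : N < 16 ^ (N + 1) :=
      (Nat.lt_pow_self (by norm_num)).trans (Nat.pow_lt_pow_right (by norm_num) (Nat.lt_succ_self N))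
    have hz : (symmDiff F G).card = 0 := by
      by_contra hpos
      have : 1 * 16 ^ (N + 1) ≤ (symmDiff F G).card * 16 ^ (N + 1) :=
        Nat.mul_le_mul_right _ (Nat.one_le_iff_ne_zero.2 hpos)
      omega
    have : symmDiff F G = ⊥ := Finset.card_eq_zero.1 hz
    rw [symmDiff_eq_bot.1 this]
    exact hG
  have heq : 𝒯 = 𝒢 := h𝒯𝒢.antisymm (h𝒢 (Nat.succ_ne_zero N))
  rw [heq]
  refine havg.trans ?_
  have hs : √(10 * V * N) = √10 * √(V * N) := by
    rw [mul_assoc, Real.sqrt_mul (by norm_num)]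
  have h10 : √(10 : ℝ) ≤ 10 / 3 := Real.sqrt_le_iff.2 ⟨by norm_num, by norm_num⟩
  have h1 : (1 - (1 / 2 : ℝ) ^ (N + 1)) ≤ 1 := by
    have : (0 : ℝ) < (1 / 2) ^ (N + 1) := by positivity
    linarith
  rw [hs]
  calc 3 * (√10 * √(V * N)) * (1 - (1 / 2) ^ (N + 1)) ≤ 3 * (√10 * √(V * N)) * 1 := by gcongr
    _ ≤ 3 * (10 / 3 * √(V * N)) * 1 := by gcongr
    _ = 10 * √(V * N) := by ring

end SignAvg

theorem ind_of_mem {E : Type*} {A : Set E} {x : E} (h : x ∈ A) : ind A x = 1 := by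
  simp [ind, h]

theorem ind_of_notMem {E : Type*} {A : Set E} {x : E} (h : x ∉ A) : ind A x = 0 := by
  simp [ind, h]

theorem signAvg_iSup_ind_le {E : Type*} {𝒜 : Set (Set E)} {V : ℕ}
    (hV : vcDimension 𝒜 ≤ V) (hV1 : 1 ≤ V) {n : ℕ} (x : Fin n → E) :
    signAvg (fun s => ⨆ A : 𝒜, |∑ i, boolSign (s i) * ind A.1 (x i)|) ≤
      10 * √(V * ∑ i, ind (⋃₀ 𝒜) (x i)) := by
  classical
  set T : Finset (Fin n) := Finset.univ.filter fun i => x i ∈ ⋃₀ 𝒜 with hT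
  have hsum : ∑ i, ind (⋃₀ 𝒜) (x i) = (T.card : ℝ) := by
    rw [hT, Finset.card_filter, Nat.cast_sum]
    refine Finset.sum_congr rfl fun i _ => ?_
    by_cases h : x i ∈ ⋃₀ 𝒜
    · rw [ind_of_mem h, if_pos h, Nat.cast_one]
    · rw [ind_of_notMem h, if_neg h, Nat.cast_zero]
  rw [hsum]
  refine le_trans (signAvg_mono fun s => ?_)
    (signAvg_maxSignSum_traceFamily_le hV hV1 x T fun F hF i hi => ?_)
  · refine Real.iSup_le (fun A => ?_) (Real.iSup_nonneg fun F => abs_nonneg _)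
    have hF : (Finset.univ.filter fun i => x i ∈ A.1) ∈ traceFamily 𝒜 x :=
      mem_traceFamily.2 ⟨A.1, A.2, by simp⟩
    refine le_trans (le_of_eq ?_) (abs_le_maxSignSum hF s)
    rw [Finset.sum_filter]
    congr 1
    refine Finset.sum_congr rfl fun i _ => ?_
    by_cases h : x i ∈ A.1
    · rw [ind_of_mem h, if_pos h, mul_one]
    · rw [ind_of_notMem h, if_neg h, mul_zero]
  · obtain ⟨A, hA, hFA⟩ := mem_traceFamily.1 hF
    rw [hT, Finset.mem_filter]
    exact ⟨Finset.mem_univ i, A, hA, (hFA i).1 hi⟩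

/-! ### A bounded difference inequality of Bernstein type -/

/-- From the second order on, compare the exponential series with a geometric one through `(k + 2)!
≥ 2 * 3 ^ k`. -/
theorem exp_le_one_add_add_sq {u l : ℝ} (hu : |u| ≤ l) (hl : l < 3) :
    Real.exp u ≤ 1 + u + u ^ 2 / (2 * (1 - l / 3)) := by
  have hl0 : 0 ≤ l := (abs_nonneg u).trans hu
  have h1 : HasSum (fun k : ℕ => u ^ k / (k.factorial : ℝ)) (Real.exp u) := by
    rw [Real.exp_eq_exp_ℝ]
    exact NormedSpace.expSeries_div_hasSum_exp u
  have h2 := (hasSum_nat_add_iff' 2).2 h1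
  have h3 : HasSum (fun k : ℕ => u ^ 2 / 2 * (l / 3) ^ k) (u ^ 2 / 2 * (1 - l / 3)⁻¹) :=
    (hasSum_geometric_of_lt_one (by positivity) (by linarith)).mul_left _
  have h4 := hasSum_le (fun k => ?_) h2 h3
  · have e : u ^ 2 / (2 * (1 - l / 3)) = u ^ 2 / 2 * (1 - l / 3)⁻¹ := by
      rw [div_mul_eq_div_div, div_eq_mul_inv (u ^ 2 / 2)]
    rw [e]
    simp [Finset.sum_range_succ] at h4
    linarith
  · have hfac : (2 : ℝ) * 3 ^ k ≤ ((k + 2).factorial : ℝ) := by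
      have := Nat.factorial_mul_pow_le_factorial (m := 2) (n := k)
      rw [add_comm k 2]
      exact_mod_cast this
    have hpow : u ^ k ≤ l ^ k :=
      (le_abs_self _).trans (by rw [abs_pow]; exact pow_le_pow_left₀ (abs_nonneg u) hu k)
    calc u ^ (k + 2) / ((k + 2).factorial : ℝ) = u ^ 2 * u ^ k / ((k + 2).factorial : ℝ) := by ring
      _ ≤ u ^ 2 * l ^ k / ((k + 2).factorial : ℝ) := by gcongr
      _ ≤ u ^ 2 * l ^ k / (2 * 3 ^ k) := by gcongr
      _ = u ^ 2 / 2 * (l / 3) ^ k := by rw [div_pow]; field_simp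

theorem ind_nonneg {E : Type*} (A : Set E) (x : E) : 0 ≤ ind A x :=
  Set.indicator_nonneg (fun _ _ => zero_le_one) x

theorem ind_le_one {E : Type*} (A : Set E) (x : E) : ind A x ≤ 1 :=
  Set.indicator_le_self' (fun _ _ => zero_le_one) x

theorem abs_ind_le_one {E : Type*} (A : Set E) (x : E) : |ind A x| ≤ 1 := by
  rw [abs_of_nonneg (ind_nonneg A x)]
  exact ind_le_one A x

theorem integrable_of_forall_abs_le {α : Type*} [MeasurableSpace α] {μ : Measure α}
    [IsFiniteMeasure μ] {f : α → ℝ} (hf : AEStronglyMeasurable f μ) {B : ℝ}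
    (h : ∀ᵐ x ∂μ, |f x| ≤ B) : Integrable f μ :=
  Integrable.of_bound hf B h

section Bernstein

variable {E : Type*} [MeasurableSpace E] {μ : Measure E} [IsProbabilityMeasure μ] {U : Set E}
  {p l : ℝ}

theorem integrable_ind (hU : AEMeasurable (ind U) μ) : Integrable (ind U) μ :=
  integrable_of_forall_abs_le hU.aestronglyMeasurable (.of_forall (abs_ind_le_one U))

theorem integrable_exp_of_abs_le {α : Type*} [MeasurableSpace α] {ν : Measure α}
    [IsFiniteMeasure ν] {f : α → ℝ} (hf : AEStronglyMeasurable f ν) {B : ℝ}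
    (h : ∀ᵐ x ∂ν, |f x| ≤ B) : Integrable (fun x => Real.exp (f x)) ν :=
  integrable_of_forall_abs_le (B := Real.exp B)
    (Real.continuous_exp.comp_aestronglyMeasurable hf) (h.mono fun x hx => by
      rw [Real.abs_exp, Real.exp_le_exp]
      exact (le_abs_self _).trans hx)

/-- Since `Y² ≤ |Y| ≤ 1_U + p`, the second moment is at most `2p`. The hypotheses hold only almost
everywhere because `Y` will come from partial integrals of an almost everywhere measurable function.
-/
theorem integral_exp_mul_le (hU : AEMeasurable (ind U) μ) (hp : ∫ x, ind U x ∂μ = p) (hl0 : 0 ≤ l)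
    (hl : l < 3) {Y : E → ℝ} (hY : AEStronglyMeasurable Y μ) (hY0 : ∫ x, Y x ∂μ = 0)
    (hY1 : ∀ᵐ x ∂μ, |Y x| ≤ 1) (hYU : ∀ᵐ x ∂μ, |Y x| ≤ ind U x + p) :
    ∫ x, Real.exp (l * Y x) ∂μ ≤ Real.exp (p * l ^ 2 / (1 - l / 3)) := by
  have hl3 : 0 < 1 - l / 3 := by linarith
  have hYi : Integrable Y μ := integrable_of_forall_abs_le hY hY1
  have hbound : ∀ᵐ x ∂μ, Real.exp (l * Y x) ≤
      1 + l * Y x + l ^ 2 / (2 * (1 - l / 3)) * (ind U x + p) := by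
    filter_upwards [hY1, hYU] with x h1 h2
    have h3 : |l * Y x| ≤ l := by
      rw [abs_mul, abs_of_nonneg hl0]
      exact mul_le_of_le_one_right hl0 h1
    refine (exp_le_one_add_add_sq h3 hl).trans ?_
    have h4 : Y x ^ 2 ≤ ind U x + p := by
      rw [← sq_abs, sq]
      exact (mul_le_of_le_one_right (abs_nonneg _) h1).trans h2
    have h5 : (l * Y x) ^ 2 / (2 * (1 - l / 3)) = l ^ 2 / (2 * (1 - l / 3)) * Y x ^ 2 := by ring
    rw [h5]
    gcongr
  have hi1 : Integrable (fun x => Real.exp (l * Y x)) μ :=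
    integrable_exp_of_abs_le (B := l) (hY.const_mul l) (hY1.mono fun x h1 => by
      rw [abs_mul, abs_of_nonneg hl0]
      exact mul_le_of_le_one_right hl0 h1)
  have hi2 : Integrable (fun x => ind U x + p) μ := (integrable_ind hU).add (integrable_const p)
  have hi3 : Integrable (fun x => 1 + l * Y x) μ := (integrable_const 1).add (hYi.const_mul l)
  have hint := integral_mono_ae hi1 (hi3.add (hi2.const_mul _)) hbound
  refine hint.trans ?_
  simp only [Pi.add_apply]
  rw [integral_add hi3 (hi2.const_mul _), integral_add (integrable_const 1) (hYi.const_mul l),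
    integral_const_mul, integral_const_mul, integral_add (integrable_ind hU) (integrable_const p),
    hY0, hp]
  simp only [integral_const, probReal_univ, smul_eq_mul, one_mul, mul_zero, add_zero]
  have e : l ^ 2 / (2 * (1 - l / 3)) * (p + p) = p * l ^ 2 / (1 - l / 3) := by field_simp; ring
  rw [e, add_comm]
  exact Real.add_one_le_exp _

/-- The exponential moments of a function with bounded differences that are small outside `U`. -/
theorem integral_exp_sub_integral_le (hU : AEMeasurable (ind U) μ) (hp : ∫ x, ind U x ∂μ = p)
    (hl0 : 0 ≤ l) (hl : l < 3) (n : ℕ) : ∀ f : (Fin n → E) → ℝ,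
    AEStronglyMeasurable f (Measure.pi fun _ => μ) → (∃ B, ∀ x, |f x| ≤ B) →
    (∀ x i z, |f x - f (Function.update x i z)| ≤ 1) →
    (∀ x i z, |f x - f (Function.update x i z)| ≤ ind U (x i) + ind U z) →
    ∫ x, Real.exp (l * (f x - ∫ y, f y ∂Measure.pi fun _ => μ)) ∂(Measure.pi fun _ => μ) ≤
      Real.exp (n * (p * l ^ 2 / (1 - l / 3))) := by
  induction n with
  | zero =>
    intro f _ _ _ _
    have h : ∀ x, f x = f default := fun x => congrArg f (Subsingleton.elim _ _)
    simp [h]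
  | succ n ih =>
    rintro f hf ⟨B, hB⟩ hd1 hdU
    set Q : Measure (Fin n → E) := Measure.pi fun _ => μ with hQ
    have hmp := (measurePreserving_piFinSuccAbove (fun _ : Fin (n + 1) => μ) 0).symm
    set F : E × (Fin n → E) → ℝ := fun z => f (Fin.cons z.1 z.2) with hF
    have hFe : F = f ∘ (MeasurableEquiv.piFinSuccAbove (fun _ : Fin (n + 1) => E) 0).symm := by
      funext z
      simp [hF, MeasurableEquiv.piFinSuccAbove_symm_apply, Fin.insertNthEquiv]
    have hFm : AEStronglyMeasurable F (μ.prod Q) := by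
      rw [hFe]
      exact hf.comp_measurePreserving hmp
    have hint : ∀ φ : ℝ → ℝ, ∫ x, φ (f x) ∂(Measure.pi fun _ => μ) = ∫ z, φ (F z) ∂(μ.prod Q) := by
      intro φ
      rw [← hmp.integral_comp']
      simp only [hFe, Function.comp]
      rfl
    have hFB : ∀ z, |F z| ≤ B := fun z => hB _
    have hFi : Integrable F (μ.prod Q) := integrable_of_forall_abs_le hFm (.of_forall hFB)
    -- The conditional mean given the first coordinate: `g - ∫ g` inherits both difference bounds
    -- and is handled by the one-variable estimate, while `F (a, ·) - g a` is left to the induction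
    -- hypothesis.
    set g : E → ℝ := fun a => ∫ y, F (a, y) ∂Q with hg
    have hgm : AEStronglyMeasurable g μ := hFm.integral_prod_right'
    have hgi : Integrable g μ := hFi.integral_prod_left
    have hEf : ∫ x, f x ∂(Measure.pi fun _ => μ) = ∫ a, g a ∂μ :=
      (hint id).trans (integral_prod F hFi)
    have hsec : ∀ᵐ a ∂μ, AEStronglyMeasurable (fun y => F (a, y)) Q := hFm.prodMk_left
    have hseci : ∀ {a}, AEStronglyMeasurable (fun y => F (a, y)) Q →
        Integrable (fun y => F (a, y)) Q := fun ha =>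
      integrable_of_forall_abs_le ha (.of_forall fun y => hFB _)
    have hupd : ∀ (a b : E) (y : Fin n → E), (Fin.cons b y : Fin (n + 1) → E) =
        Function.update (Fin.cons a y : Fin (n + 1) → E) 0 b :=
      fun a b y => (Fin.update_cons_zero (α := fun _ => E) a y b).symm
    have hgd : ∀ {a b}, AEStronglyMeasurable (fun y => F (a, y)) Q →
        AEStronglyMeasurable (fun y => F (b, y)) Q → ∀ c : ℝ,
        (∀ y, |F (a, y) - F (b, y)| ≤ c) → |g a - g b| ≤ c := by
      intro a b ha hb c hc
      rw [hg]
      simp only []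
      rw [← integral_sub (hseci ha) (hseci hb)]
      have := norm_integral_le_of_norm_le_const (μ := Q)
        (f := fun y => F (a, y) - F (b, y)) (C := c) (.of_forall hc)
      simpa using this
    have hdev : ∀ a, AEStronglyMeasurable (fun y => F (a, y)) Q →
        g a - ∫ b, g b ∂μ = ∫ b, (g a - g b) ∂μ := by
      intro a _
      rw [integral_sub (integrable_const _) hgi]
      simp
    have hY1 : ∀ᵐ a ∂μ, |g a - ∫ b, g b ∂μ| ≤ 1 := by
      filter_upwards [hsec] with a ha
      rw [hdev a ha]
      have := norm_integral_le_of_norm_le_const (μ := μ) (f := fun b => g a - g b) (C := 1)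
        (hsec.mono fun b hb => hgd ha hb 1 fun y => by
          have := hd1 (Fin.cons a y) 0 b
          rwa [← hupd] at this)
      simpa using this
    have hYU : ∀ᵐ a ∂μ, |g a - ∫ b, g b ∂μ| ≤ ind U a + p := by
      filter_upwards [hsec] with a ha
      rw [hdev a ha]
      have := norm_integral_le_of_norm_le (μ := μ) (f := fun b => g a - g b)
        (g := fun b => ind U a + ind U b) ((integrable_const _).add (integrable_ind hU))
        (hsec.mono fun b hb => hgd ha hb _ fun y => by
          have := hdU (Fin.cons a y) 0 b
          rwa [← hupd, Fin.cons_zero] at this)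
      rw [integral_add (integrable_const _) (integrable_ind hU), hp] at this
      simpa using this
    set c : ℝ := p * l ^ 2 / (1 - l / 3) with hc
    set m : ℝ := ∫ b, g b ∂μ with hm
    have hY0 : ∫ a, (g a - m) ∂μ = 0 := by
      rw [integral_sub hgi (integrable_const _)]
      simp [hm]
    have hYm : AEStronglyMeasurable (fun a => g a - m) μ :=
      hgm.sub aestronglyMeasurable_const
    have hone := integral_exp_mul_le hU hp hl0 hl hYm hY0 hY1 hYU
    have hIH : ∀ᵐ a ∂μ, ∫ y, Real.exp (l * (F (a, y) - g a)) ∂Q ≤ Real.exp (n * c) := by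
      filter_upwards [hsec] with a ha
      refine ih (fun y => F (a, y)) ha ⟨B, fun y => hFB _⟩ (fun y i z => ?_) fun y i z => ?_
      · have := hd1 (Fin.cons a y) i.succ z
        rwa [← Fin.cons_update] at this
      · have := hdU (Fin.cons a y) i.succ z
        rwa [← Fin.cons_update, Fin.cons_succ] at this
    have hbig : Integrable (fun z => Real.exp (l * (F z - m))) (μ.prod Q) := by
      refine integrable_exp_of_abs_le (B := l * (B + |m|))
        ((hFm.sub aestronglyMeasurable_const).const_mul l) (.of_forall fun z => ?_)
      rw [abs_mul, abs_of_nonneg hl0]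
      refine mul_le_mul_of_nonneg_left ((abs_sub _ _).trans ?_) hl0
      linarith [hFB z]
    have hgexp : Integrable (fun a => Real.exp (l * (g a - m))) μ :=
      integrable_exp_of_abs_le (B := l) (hYm.const_mul l) (hY1.mono fun x h1 => by
        rw [abs_mul, abs_of_nonneg hl0]
        exact mul_le_of_le_one_right hl0 h1)
    rw [hEf, hint fun t => Real.exp (l * (t - m)), integral_prod _ hbig]
    have hstep : ∀ᵐ a ∂μ, ∫ y, Real.exp (l * (F (a, y) - m)) ∂Q ≤
        Real.exp (n * c) * Real.exp (l * (g a - m)) := by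
      filter_upwards [hIH] with a ha
      have e : ∀ y, Real.exp (l * (F (a, y) - m)) =
          Real.exp (l * (F (a, y) - g a)) * Real.exp (l * (g a - m)) := by
        intro y
        rw [← Real.exp_add]
        ring_nf
      simp only [e]
      rw [integral_mul_const]
      exact mul_le_mul_of_nonneg_right ha (Real.exp_pos _).le
    refine (integral_mono_ae hbig.integral_prod_left (hgexp.const_mul _) hstep).trans ?_
    rw [integral_const_mul]
    refine (mul_le_mul_of_nonneg_left hone (Real.exp_pos _).le).trans ?_
    rw [← Real.exp_add, Real.exp_le_exp]
    push_cast
    linarith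

/-- The tail bound that follows from `integral_exp_sub_integral_le`. -/
theorem measureReal_deviation_le (hU : AEMeasurable (ind U) μ) (hp : ∫ x, ind U x ∂μ = p)
    {n : ℕ} {f : (Fin n → E) → ℝ}
    (hf : AEStronglyMeasurable f (Measure.pi fun _ => μ)) {B : ℝ} (hB : ∀ x, |f x| ≤ B)
    (hd1 : ∀ x i z, |f x - f (Function.update x i z)| ≤ 1)
    (hdU : ∀ x i z, |f x - f (Function.update x i z)| ≤ ind U (x i) + ind U z)
    {s : ℝ} (hs : 0 < s) :
    (Measure.pi fun _ : Fin n => μ).real {x | n * p * (2 * s + s ^ 2 / 3) ≤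
      f x - ∫ y, f y ∂Measure.pi fun _ => μ} ≤ Real.exp (-(n * p * s ^ 2)) := by
  -- With this `l`, `1 - l / 3 = 1 / (1 + s / 3)` and the Chernoff exponent is exactly `-(n * p * s
  -- ^ 2)`.
  set l : ℝ := s / (1 + s / 3) with hl
  set m : ℝ := ∫ y, f y ∂Measure.pi fun _ => μ with hm
  have hl0 : 0 ≤ l := by positivity
  have hl3 : l < 3 := by
    rw [hl, div_lt_iff₀ (by positivity)]
    linarith
  have h1 := integral_exp_sub_integral_le hU hp hl0 hl3 n f hf ⟨B, hB⟩ hd1 hdU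
  have hint : Integrable (fun x => Real.exp (l * (f x - m))) (Measure.pi fun _ : Fin n => μ) := by
    refine integrable_exp_of_abs_le (B := l * (B + |m|))
      ((hf.sub aestronglyMeasurable_const).const_mul l) (.of_forall fun z => ?_)
    rw [abs_mul, abs_of_nonneg hl0]
    refine mul_le_mul_of_nonneg_left ((abs_sub _ _).trans ?_) hl0
    linarith [hB z]
  have h2 := measure_ge_le_exp_mul_mgf (X := fun x => f x - m) (n * p * (2 * s + s ^ 2 / 3))
    hl0 hint
  refine h2.trans ((mul_le_mul_of_nonneg_left h1 (Real.exp_pos _).le).trans ?_)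
  rw [← Real.exp_add, Real.exp_le_exp]
  have e1 : 1 - l / 3 = 1 / (1 + s / 3) := by
    rw [hl]
    field_simp
    ring
  rw [e1, hl]
  apply le_of_eq
  field_simp
  ring

end Bernstein

/-! ### Suprema of weighted counts -/

theorem iSup_le_iSup_add {α : Type*} {f g : α → ℝ} (hg : BddAbove (Set.range g)) {b : ℝ}
    (hb : 0 ≤ b) (h : ∀ a, f a ≤ g a + b) : ⨆ a, f a ≤ (⨆ a, g a) + b := by
  rcases isEmpty_or_nonempty α with hα | hα
  · simpa [Real.iSup_of_isEmpty] using hb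
  · exact ciSup_le fun a => (h a).trans (add_le_add_left (le_ciSup hg a) b)

theorem abs_iSup_sub_iSup_le {α : Type*} {f g : α → ℝ} (hf : BddAbove (Set.range f))
    (hg : BddAbove (Set.range g)) {b : ℝ} (hb : 0 ≤ b) (h : ∀ a, |f a - g a| ≤ b) :
    |(⨆ a, f a) - ⨆ a, g a| ≤ b := by
  rw [abs_sub_le_iff]
  constructor
  · have := iSup_le_iSup_add (f := f) hg hb fun a => by linarith [(abs_sub_le_iff.1 (h a)).1]
    linarith
  · have := iSup_le_iSup_add (f := g) hf hb fun a => by linarith [(abs_sub_le_iff.1 (h a)).2]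
    linarith

/-- The supremum over the class `𝒜` of `|c μ(A) + ∑ i, e i 1_A(x i)|`. -/
noncomputable def supSum {E ι : Type*} [MeasurableSpace E] [Fintype ι] (μ : Measure E)
    (𝒜 : Set (Set E)) (c : ℝ) (e : ι → ℝ) (x : ι → E) : ℝ :=
  ⨆ A : 𝒜, |c * μ.real (A : Set E) + ∑ i, e i * ind A.1 (x i)|

section SupSum

variable {E ι κ : Type*} [MeasurableSpace E] [Fintype ι] [Fintype κ] {μ : Measure E}
  {𝒜 : Set (Set E)}

theorem abs_add_sum_ind_le [IsProbabilityMeasure μ] (c : ℝ) (e : ι → ℝ) (x : ι → E) (A : Set E) :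
    |c * μ.real A + ∑ i, e i * ind A (x i)| ≤ |c| + ∑ i, |e i| := by
  refine (abs_add_le _ _).trans (add_le_add ?_ ?_)
  · rw [abs_mul, abs_of_nonneg measureReal_nonneg]
    exact mul_le_of_le_one_right (abs_nonneg c) measureReal_le_one
  · refine (Finset.abs_sum_le_sum_abs _ _).trans (Finset.sum_le_sum fun i _ => ?_)
    rw [abs_mul]
    exact mul_le_of_le_one_right (abs_nonneg _) (abs_ind_le_one A (x i))

theorem bddAbove_supSum [IsProbabilityMeasure μ] (c : ℝ) (e : ι → ℝ) (x : ι → E) :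
    BddAbove (Set.range fun A : 𝒜 => |c * μ.real (A : Set E) + ∑ i, e i * ind A.1 (x i)|) :=
  ⟨|c| + ∑ i, |e i|, by
    rintro _ ⟨A, rfl⟩
    exact abs_add_sum_ind_le c e x A.1⟩

theorem le_supSum [IsProbabilityMeasure μ] (c : ℝ) (e : ι → ℝ) (x : ι → E) {A : Set E}
    (hA : A ∈ 𝒜) : |c * μ.real A + ∑ i, e i * ind A (x i)| ≤ supSum μ 𝒜 c e x :=
  le_ciSup (bddAbove_supSum c e x) (⟨A, hA⟩ : 𝒜)

theorem supSum_nonneg (c : ℝ) (e : ι → ℝ) (x : ι → E) : 0 ≤ supSum μ 𝒜 c e x :=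
  Real.iSup_nonneg fun _ => abs_nonneg _

theorem abs_supSum_le [IsProbabilityMeasure μ] (c : ℝ) (e : ι → ℝ) (x : ι → E) :
    |supSum μ 𝒜 c e x| ≤ |c| + ∑ i, |e i| := by
  rw [abs_of_nonneg (supSum_nonneg c e x)]
  exact Real.iSup_le (fun A => abs_add_sum_ind_le c e x A.1)
    (add_nonneg (abs_nonneg c) (Finset.sum_nonneg fun i _ => abs_nonneg _))

/-- Relabelling extends the measurability hypothesis from `Fin m` to every finite index type, and
lets the symmetrization move a permutation from the coefficients to the sample. -/
theorem supSum_comp_equiv (σ : ι ≃ κ) (c : ℝ) (e : κ → ℝ) (x : ι → E) :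
    supSum μ 𝒜 c (e ∘ σ) x = supSum μ 𝒜 c e (x ∘ σ.symm) := by
  unfold supSum
  congr 1
  funext A
  congr 2
  exact Fintype.sum_equiv σ _ _ fun i => by simp

theorem supSum_neg_zero (e : ι → ℝ) (x : ι → E) :
    supSum μ 𝒜 0 (fun i => -e i) x = supSum μ 𝒜 0 e x := by
  unfold supSum
  congr 1
  funext A
  simp only [zero_mul, zero_add, neg_mul, Finset.sum_neg_distrib, abs_neg]

theorem supSum_elim_le [IsProbabilityMeasure μ] (e : ι → ℝ) (e' : κ → ℝ) (x : ι → E) (y : κ → E) :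
    supSum μ 𝒜 0 (Sum.elim e e') (Sum.elim x y) ≤ supSum μ 𝒜 0 e x + supSum μ 𝒜 0 e' y := by
  refine Real.iSup_le (fun A => ?_) (add_nonneg (supSum_nonneg _ _ _) (supSum_nonneg _ _ _))
  have h1 := le_supSum (μ := μ) 0 e x A.2
  have h2 := le_supSum (μ := μ) 0 e' y A.2
  rw [Fintype.sum_sum_type]
  simp only [Sum.elim_inl, Sum.elim_inr, zero_mul, zero_add] at h1 h2 ⊢
  exact (abs_add_le _ _).trans (add_le_add h1 h2)

theorem measurePreserving_comp_equiv_symm [IsProbabilityMeasure μ] (σ : ι ≃ κ) :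
    MeasurePreserving (fun x : ι → E => x ∘ σ.symm) (Measure.pi fun _ => μ)
      (Measure.pi fun _ => μ) := by
  have h := measurePreserving_piCongrLeft (fun _ : κ => μ) σ
  convert h using 1
  funext x
  funext k
  obtain ⟨i, rfl⟩ := σ.surjective k
  rw [MeasurableEquiv.coe_piCongrLeft, Equiv.piCongrLeft_apply_apply]
  simp

theorem aestronglyMeasurable_supSum [IsProbabilityMeasure μ] (h𝒜 : IsMeasurableClass μ 𝒜) (c : ℝ)
    (e : ι → ℝ) : AEStronglyMeasurable (supSum μ 𝒜 c e) (Measure.pi fun _ => μ) := by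
  set σ := Fintype.equivFin ι
  have h := (h𝒜.aemeasurable_iSup _ c (e ∘ σ.symm)).aestronglyMeasurable.comp_measurePreserving
    (measurePreserving_comp_equiv_symm (μ := μ) σ)
  refine h.congr (.of_forall fun x => ?_)
  have := supSum_comp_equiv (μ := μ) (𝒜 := 𝒜) σ c (e ∘ σ.symm) x
  rw [Function.comp_assoc, Equiv.symm_comp_self, Function.comp_id] at this
  exact this.symm

theorem integrable_supSum [IsProbabilityMeasure μ] (h𝒜 : IsMeasurableClass μ 𝒜) (c : ℝ)
    (e : ι → ℝ) : Integrable (supSum μ 𝒜 c e) (Measure.pi fun _ => μ) :=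
  integrable_of_forall_abs_le (aestronglyMeasurable_supSum h𝒜 c e)
    (.of_forall (abs_supSum_le c e))

theorem integral_supSum_comp_equiv [IsProbabilityMeasure μ] (h𝒜 : IsMeasurableClass μ 𝒜)
    (σ : ι ≃ κ) (c : ℝ) (e : κ → ℝ) :
    ∫ x, supSum μ 𝒜 c (e ∘ σ) x ∂(Measure.pi fun _ => μ) =
      ∫ x, supSum μ 𝒜 c e x ∂(Measure.pi fun _ => μ) := by
  have hmp := measurePreserving_comp_equiv_symm (μ := μ) σ
  simp only [supSum_comp_equiv]
  rw [← hmp.map_eq, integral_map hmp.aemeasurable]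
  rw [hmp.map_eq]
  exact aestronglyMeasurable_supSum h𝒜 c e

theorem sumPiEquivProdPi_symm_eq_elim {E ι κ : Type*} [MeasurableSpace E] (z : (ι → E) × (κ → E)) :
    (MeasurableEquiv.sumPiEquivProdPi (fun _ : ι ⊕ κ => E)).symm z = Sum.elim z.1 z.2 := by
  funext q
  cases q <;> rfl

theorem integrable_supSum_elim [IsProbabilityMeasure μ] (h𝒜 : IsMeasurableClass μ 𝒜)
    (e : ι ⊕ κ → ℝ) :
    Integrable (fun z : (ι → E) × (κ → E) => supSum μ 𝒜 0 e (Sum.elim z.1 z.2))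
      ((Measure.pi fun _ => μ).prod (Measure.pi fun _ => μ)) := by
  have hmp := measurePreserving_sumPiEquivProdPi_symm (fun _ : ι ⊕ κ => μ)
  have h := (hmp.integrable_comp_emb (MeasurableEquiv.measurableEmbedding _)).2
    (integrable_supSum h𝒜 0 e)
  refine h.congr (.of_forall fun z => ?_)
  simp only [Function.comp, sumPiEquivProdPi_symm_eq_elim]

theorem integral_supSum_elim [IsProbabilityMeasure μ] (e : ι ⊕ κ → ℝ) :
    ∫ z : (ι → E) × (κ → E), supSum μ 𝒜 0 e (Sum.elim z.1 z.2)
      ∂((Measure.pi fun _ => μ).prod (Measure.pi fun _ => μ)) =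
      ∫ x, supSum μ 𝒜 0 e x ∂(Measure.pi fun _ => μ) := by
  have hmp := measurePreserving_sumPiEquivProdPi_symm (fun _ : ι ⊕ κ => μ)
  rw [← hmp.integral_comp']
  refine integral_congr_ae (.of_forall fun z => ?_)
  simp only [sumPiEquivProdPi_symm_eq_elim]

/-! ### Symmetrization -/

/-- The permutation of two copies of `ι` that exchanges them at the indices where `s` is false. -/
def swapFalse {ι : Type*} (s : ι → Bool) : Equiv.Perm (ι ⊕ ι) :=
  Function.Involutive.toPerm
    (Sum.elim (fun i => cond (s i) (Sum.inl i) (Sum.inr i))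
      (fun i => cond (s i) (Sum.inr i) (Sum.inl i))) (by
    rintro (i | i) <;> cases h : s i <;> simp [h])

theorem elim_comp_swapFalse {ι : Type*} (s : ι → Bool) :
    (Sum.elim (fun _ => (-1 : ℝ)) fun _ => 1) ∘ swapFalse s =
      Sum.elim (fun i => -boolSign (s i)) fun i => boolSign (s i) := by
  funext q
  rcases q with i | i <;> cases h : s i <;>
    simp [swapFalse, Function.Involutive.toPerm, boolSign, h]

theorem integrable_comp_eval_ind [IsProbabilityMeasure μ] {A : Set E} (hA : MeasurableSet A)
    (i : ι) : Integrable (fun x : ι → E => ind A (x i)) (Measure.pi fun _ => μ) :=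
  integrable_of_forall_abs_le (((measurable_const (a := (1 : ℝ))).indicator hA).comp
    (measurable_pi_apply i)).aestronglyMeasurable (.of_forall fun _ => abs_ind_le_one _ _)

theorem integral_comp_eval_pi [IsProbabilityMeasure μ] {g : E → ℝ} (hg : AEStronglyMeasurable g μ)
    (i : ι) : ∫ x : ι → E, g (x i) ∂(Measure.pi fun _ => μ) = ∫ a, g a ∂μ := by
  have hmp := measurePreserving_eval (fun _ : ι => μ) i
  have h := integral_map (f := g) hmp.aemeasurable (by rw [hmp.map_eq]; exact hg)
  rw [hmp.map_eq] at h
  exact h.symm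

/-- The joint law of the sample and a ghost sample is invariant under exchanging their `i`-th points
wherever `s i` is false, which turns the coefficients `(-1, 1)` into `(-s, s)`. The triangle
inequality then separates the two copies. -/
theorem integral_supSum_le_two_mul [IsProbabilityMeasure μ] (h𝒜 : IsMeasurableClass μ 𝒜)
    (s : ι → Bool) :
    ∫ x, supSum μ 𝒜 (Fintype.card ι) (fun _ : ι => -1) x ∂(Measure.pi fun _ => μ) ≤
      2 * ∫ x, supSum μ 𝒜 0 (fun i => boolSign (s i)) x ∂(Measure.pi fun _ => μ) := by
  set Q : Measure (ι → E) := Measure.pi fun _ => μ with hQ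
  set e : ι ⊕ ι → ℝ := Sum.elim (fun _ => -1) fun _ => 1 with he
  have hGi := integrable_supSum_elim h𝒜 e
  -- Jensen: `μ(A)` is the mean of the ghost empirical measure, and the supremum of the means is at
  -- most the mean of the supremum.
  have h1 : ∀ᵐ x ∂Q, supSum μ 𝒜 (Fintype.card ι) (fun _ : ι => -1) x ≤
      ∫ y, supSum μ 𝒜 0 e (Sum.elim x y) ∂Q := by
    filter_upwards [hGi.prod_right_ae] with x hx
    refine Real.iSup_le (fun A => ?_) (integral_nonneg fun y => supSum_nonneg _ _ _)
    have hA := h𝒜.measurableSet A.1 A.2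
    have hindm : AEStronglyMeasurable (ind A.1) μ :=
      ((measurable_const (a := (1 : ℝ))).indicator hA).aestronglyMeasurable
    have hsum : Integrable (fun y : ι → E => ∑ i, ind A.1 (y i)) Q :=
      integrable_finsetSum _ fun i _ => integrable_comp_eval_ind hA i
    have hindint : ∫ a, ind A.1 a ∂μ = μ.real A.1 := by
      have := integral_indicator_one (μ := μ) hA
      exact this
    have e1 : (Fintype.card ι : ℝ) * μ.real A.1 + ∑ i, (-1) * ind A.1 (x i) =
        ∫ y, (∑ i, ind A.1 (y i) - ∑ i, ind A.1 (x i)) ∂Q := by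
      rw [integral_sub hsum (integrable_const _),
        integral_finsetSum _ fun i _ => integrable_comp_eval_ind hA i]
      simp only [hQ, integral_comp_eval_pi hindm, hindint]
      simp
      ring
    rw [e1]
    refine (norm_integral_le_of_norm_le (μ := Q)
      (f := fun y : ι → E => ∑ i, ind A.1 (y i) - ∑ i, ind A.1 (x i)) hx (.of_forall fun y => ?_))
    refine le_trans (le_of_eq ?_) (le_supSum (μ := μ) 0 e (Sum.elim x y) A.2)
    rw [Fintype.sum_sum_type]
    simp only [he, Sum.elim_inl, Sum.elim_inr, zero_mul, zero_add, Real.norm_eq_abs, one_mul,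
      neg_mul, Finset.sum_neg_distrib]
    congr 1
    ring
  have h2 := integral_mono_ae (integrable_supSum h𝒜 _ _) hGi.integral_prod_left h1
  rw [← integral_prod _ hGi, integral_supSum_elim] at h2
  rw [← integral_supSum_comp_equiv h𝒜 (swapFalse s) 0 e, he, elim_comp_swapFalse,
    ← integral_supSum_elim] at h2
  refine h2.trans ?_
  have hi := integrable_supSum (ι := ι) h𝒜 0 (fun i => boolSign (s i))
  have h3 := integral_mono (integrable_supSum_elim h𝒜
      (Sum.elim (fun i => -boolSign (s i)) fun i => boolSign (s i)))
    ((hi.comp_fst Q).add (hi.comp_snd Q))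
    (fun z => by
      have := supSum_elim_le (μ := μ) (𝒜 := 𝒜) (fun i => -boolSign (s i))
        (fun i => boolSign (s i)) z.1 z.2
      rwa [supSum_neg_zero] at this)
  refine h3.trans (le_of_eq ?_)
  simp only [Pi.add_apply]
  rw [integral_add (hi.comp_fst Q) (hi.comp_snd Q), integral_fun_fst, integral_fun_snd]
  simp
  ring

end SupSum

/-! ### Random signs -/

/-- As a finite sum of point masses, the law of the signs needs integrability only for each fixed
sign vector, with no joint measurability of the supremum in sample and signs. -/
theorem pi_rademacherLaw_eq (n : ℕ) :
    (Measure.pi fun _ : Fin n => rademacherLaw) =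
      ∑ s : Fin n → Bool, ((2⁻¹ : ENNReal) ^ n) • Measure.dirac fun i => boolSign (s i) := by
  classical
  have hfin : IsProbabilityMeasure rademacherLaw := by
    constructor
    simp [rademacherLaw, ENNReal.inv_two_add_inv_two]
  refine Measure.pi_eq fun S hS => ?_
  have h1 : ∀ i, rademacherLaw (S i) =
      ∑ b : Bool, 2⁻¹ * (if boolSign b ∈ S i then (1 : ENNReal) else 0) := by
    intro i
    rw [Fintype.sum_bool]
    by_cases h1 : (1 : ℝ) ∈ S i <;> by_cases h2 : (-1 : ℝ) ∈ S i <;>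
      simp [rademacherLaw, Measure.dirac_apply' _ (hS i), boolSign, h1, h2]
  simp only [h1]
  rw [Fintype.prod_sum, Measure.finsetSum_apply]
  refine Finset.sum_congr rfl fun s _ => ?_
  rw [Measure.smul_apply, Measure.dirac_apply' _ (MeasurableSet.univ_pi hS), smul_eq_mul,
    Finset.prod_mul_distrib, Finset.prod_const, Finset.card_univ, Fintype.card_fin,
    Finset.prod_ite_zero]
  simp [Set.indicator_apply]

theorem prod_pi_rademacherLaw_eq {α : Type*} [MeasurableSpace α] (ν : Measure α) [SFinite ν]
    (n : ℕ) :
    ν.prod (Measure.pi fun _ : Fin n => rademacherLaw) =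
      ∑ s : Fin n → Bool, ((2⁻¹ : ENNReal) ^ n) • ν.map fun x => (x, fun i => boolSign (s i)) := by
  rw [pi_rademacherLaw_eq, ← Measure.sum_fintype, Measure.prod_sum_right, ← Measure.sum_fintype]
  congr 1
  funext s
  rw [Measure.prod_smul_right, Measure.prod_dirac]

theorem integral_prod_pi_rademacherLaw {α : Type*} [MeasurableSpace α] (ν : Measure α) [SFinite ν]
    (n : ℕ) {F : α × (Fin n → ℝ) → ℝ}
    (hF : ∀ s : Fin n → Bool, Integrable (fun x => F (x, fun i => boolSign (s i))) ν) :
    ∫ z, F z ∂(ν.prod (Measure.pi fun _ : Fin n => rademacherLaw)) =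
      signAvg fun s => ∫ x, F (x, fun i => boolSign (s i)) ∂ν := by
  have hemb : ∀ s : Fin n → Bool, MeasurableEmbedding
      fun x : α => (x, fun i => boolSign (s i)) := fun s => measurableEmbedding_prod_mk_right _
  rw [prod_pi_rademacherLaw_eq, integral_finsetSum_measure]
  · simp only [integral_smul_measure, (hemb _).integral_map]
    rw [signAvg, Finset.mul_sum]
    refine Finset.sum_congr rfl fun s _ => ?_
    simp
  · intro s _
    exact (((hemb s).integrable_map_iff).2 (hF s)).smul_measure (by simp)

theorem relRademacher_eq {E : Type*} [MeasurableSpace E] {μ : Measure E} [IsProbabilityMeasure μ]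
    {𝒜 : Set (Set E)} (h𝒜 : IsMeasurableClass μ 𝒜) (n : ℕ) :
    relRademacher μ 𝒜 n = 1 / (n * unionProb μ 𝒜) * signAvg fun s : Fin n → Bool =>
      ∫ x, supSum μ 𝒜 0 (fun i => boolSign (s i)) x ∂(Measure.pi fun _ => μ) := by
  have hc : (0 : ℝ) ≤ 1 / (n * unionProb μ 𝒜) := by
    have : 0 ≤ unionProb μ 𝒜 := measureReal_nonneg
    positivity
  have h : ∀ (e : Fin n → ℝ) (x : Fin n → E),
      ⨆ A : 𝒜, 1 / ((n : ℝ) * unionProb μ 𝒜) * |∑ i, e i * ind A.1 (x i)| =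
        1 / (n * unionProb μ 𝒜) * supSum μ 𝒜 0 e x := by
    intro e x
    rw [supSum, Real.mul_iSup_of_nonneg hc]
    simp only [zero_mul, zero_add]
  unfold relRademacher
  simp only [h]
  rw [integral_prod_pi_rademacherLaw _ n fun s => (integrable_supSum h𝒜 0 _).const_mul _]
  simp only [integral_const_mul]
  exact signAvg_const_mul _ _

/-! ### Maximal deviations over a class of sets -/

section Deviation

variable {E : Type*} [MeasurableSpace E] {μ : Measure E} [IsProbabilityMeasure μ]
  {𝒜 : Set (Set E)}

theorem ind_mono {E : Type*} {A B : Set E} (h : A ⊆ B) (x : E) : ind A x ≤ ind B x :=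
  Set.indicator_le_indicator_of_subset h (fun _ => zero_le_one) x

/-- The supremum of the indicators is the indicator of the union. Hence the class hypothesis for a
sample of size one makes the possibly uncountable union null measurable. -/
theorem supSum_fin_one {E : Type*} [MeasurableSpace E] {μ : Measure E} {𝒜 : Set (Set E)}
    (x : Fin 1 → E) :
    supSum μ 𝒜 0 (fun _ => 1) x = ind (⋃₀ 𝒜) (x 0) := by
  have h : ∀ A : 𝒜, |(0 : ℝ) * μ.real (A : Set E) + ∑ i : Fin 1, 1 * ind A.1 (x i)| =
      ind A.1 (x 0) := fun A => by simp [abs_of_nonneg (ind_nonneg A.1 (x 0))]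
  unfold supSum
  simp only [h]
  refine le_antisymm (Real.iSup_le (fun A => ind_mono (Set.subset_sUnion_of_mem A.2) _)
    (ind_nonneg _ _)) ?_
  by_cases hx : x 0 ∈ ⋃₀ 𝒜
  · obtain ⟨A, hA, hxA⟩ := hx
    have hbdd : BddAbove (Set.range fun A : 𝒜 => ind A.1 (x 0)) := ⟨1, by
      rintro _ ⟨B, rfl⟩
      exact ind_le_one _ _⟩
    refine (ind_le_one _ _).trans ?_
    rw [← ind_of_mem hxA]
    exact le_ciSup hbdd ⟨A, hA⟩
  · rw [ind_of_notMem hx]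
    exact Real.iSup_nonneg fun A => ind_nonneg _ _

theorem aemeasurable_ind_sUnion (h𝒜 : IsMeasurableClass μ 𝒜) :
    AEMeasurable (ind (⋃₀ 𝒜)) μ := by
  have h1 := aestronglyMeasurable_supSum h𝒜 0 (fun _ : Fin 1 => 1)
  have hmp := (measurePreserving_funUnique μ (Fin 1)).symm
  have h2 := h1.comp_measurePreserving hmp
  refine (h2.congr (.of_forall fun a => ?_)).aemeasurable
  exact supSum_fin_one _

theorem integral_ind_sUnion (h𝒜 : IsMeasurableClass μ 𝒜) :
    ∫ x, ind (⋃₀ 𝒜) x ∂μ = unionProb μ 𝒜 := by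
  have hU : NullMeasurableSet (⋃₀ 𝒜) μ := by
    have h := (aemeasurable_ind_sUnion h𝒜).nullMeasurableSet_preimage (measurableSet_Ici (a := 1))
    convert h using 1
    ext x
    by_cases hx : x ∈ ⋃₀ 𝒜
    · simp only [hx, Set.mem_preimage, ind_of_mem, Set.mem_Ici, le_refl]
    · simp only [hx, Set.mem_preimage, ind_of_notMem hx, Set.mem_Ici, false_iff, not_le,
        zero_lt_one]
  have h := integral_indicator₀ (μ := μ) (f := fun _ => (1 : ℝ)) hU
  refine h.trans ?_
  simp [unionProb]

theorem abs_supSum_sub_update_le {ι : Type*} [Fintype ι] [DecidableEq ι] (c : ℝ) (x : ι → E)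
    (i : ι) (z : E) {b : ℝ} (hb : 0 ≤ b) (h : ∀ A ∈ 𝒜, |ind A (x i) - ind A z| ≤ b) :
    |supSum μ 𝒜 c (fun _ => -1) x - supSum μ 𝒜 c (fun _ => -1) (Function.update x i z)| ≤ b := by
  refine abs_iSup_sub_iSup_le (bddAbove_supSum _ _ _) (bddAbove_supSum _ _ _) hb fun A => ?_
  refine (abs_abs_sub_abs_le _ _).trans ?_
  rw [add_sub_add_left_eq_sub, ← Finset.sum_sub_distrib, Finset.sum_eq_single i]
  · rw [Function.update_self, ← mul_sub, abs_mul, abs_neg, abs_one, one_mul]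
    exact h A.1 A.2
  · intro j _ hj
    rw [Function.update_of_ne hj, sub_self]
  · simp

theorem supSum_neg_one_eq {E : Type*} [MeasurableSpace E] {μ : Measure E} {𝒜 : Set (Set E)}
    {n : ℕ} (hn : 1 ≤ n) (x : Fin n → E) :
    supSum μ 𝒜 n (fun _ => -1) x = n * maxDeviation μ 𝒜 x := by
  have hn' : (0 : ℝ) < n := by exact_mod_cast hn
  unfold supSum maxDeviation
  rw [Real.mul_iSup_of_nonneg hn'.le]
  congr 1
  funext A
  rw [← abs_of_pos hn', ← abs_mul, abs_of_pos hn', mul_sub, ← mul_assoc, mul_one_div_cancel hn'.ne',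
    one_mul, sub_eq_add_neg, ← Finset.sum_neg_distrib]
  simp

theorem integral_maxDeviation_le (h𝒜 : IsMeasurableClass μ 𝒜) {n : ℕ} (hn : 1 ≤ n)
    (hp : 0 < unionProb μ 𝒜) :
    ∫ x : Fin n → E, supSum μ 𝒜 n (fun _ => -1) x ∂(Measure.pi fun _ => μ) ≤
      2 * (n * unionProb μ 𝒜 * relRademacher μ 𝒜 n) := by
  have hn' : (0 : ℝ) < n := by exact_mod_cast hn
  rw [relRademacher_eq h𝒜, ← mul_assoc ((n : ℝ) * unionProb μ 𝒜),
    mul_one_div_cancel (by positivity), one_mul,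
    ← signAvg_const_mul]
  refine le_trans (le_of_eq ?_) (signAvg_mono fun s => integral_supSum_le_two_mul h𝒜 s)
  rw [signAvg_const, Fintype.card_fin]

/-- The maximal deviation, relative to the probability of the union of the class, exceeds twice the
relative Rademacher average by a Bernstein term with small probability only. -/
theorem measureReal_maxDeviation_gt_le (h𝒜 : IsMeasurableClass μ 𝒜) {n : ℕ} (hn : 1 ≤ n)
    (hp : 0 < unionProb μ 𝒜) {L : ℝ} (hL : 0 < L) :
    (Measure.pi fun _ : Fin n => μ).real {x | 2 * relRademacher μ 𝒜 n +
      2 / (3 * n * unionProb μ 𝒜) * L + 2 * √(1 / (n * unionProb μ 𝒜) * L) <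
        1 / unionProb μ 𝒜 * maxDeviation μ 𝒜 x} ≤ Real.exp (-L) := by
  set p := unionProb μ 𝒜 with hpdef
  have hn' : (0 : ℝ) < n := by exact_mod_cast hn
  set s : ℝ := √(1 / (n * p) * L) with hs
  have hs0 : 0 < s := Real.sqrt_pos.2 (by positivity)
  have hss : s ^ 2 = 1 / (n * p) * L := Real.sq_sqrt (by positivity)
  have htail := measureReal_deviation_le (aemeasurable_ind_sUnion h𝒜) (integral_ind_sUnion h𝒜)
    (aestronglyMeasurable_supSum h𝒜 (n : ℝ) fun _ : Fin n => -1) (abs_supSum_le _ _)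
    (fun x i z => abs_supSum_sub_update_le _ x i z zero_le_one fun A _ => by
      rw [abs_sub_le_iff]
      constructor <;> linarith [ind_nonneg A (x i), ind_nonneg A z, ind_le_one A (x i),
        ind_le_one A z])
    (fun x i z => abs_supSum_sub_update_le _ x i z
      (add_nonneg (ind_nonneg _ _) (ind_nonneg _ _)) fun A hA => by
        have h1 := ind_mono (Set.subset_sUnion_of_mem hA) (x i)
        have h2 := ind_mono (Set.subset_sUnion_of_mem hA) z
        rw [abs_sub_le_iff]
        constructor <;> linarith [ind_nonneg A (x i), ind_nonneg A z])
    hs0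
  have hexp : (n : ℝ) * p * s ^ 2 = L := by
    rw [hss]
    field_simp
  rw [← hpdef, hexp] at htail
  refine le_trans (measureReal_mono fun x hx => ?_) htail
  rw [Set.mem_ofPred_eq] at hx ⊢
  have hE := integral_maxDeviation_le h𝒜 hn hp
  rw [← hpdef] at hE
  rw [supSum_neg_one_eq hn]
  have hnp : 0 < (n : ℝ) * p := by positivity
  have h1 := mul_lt_mul_of_pos_left hx hnp
  have e1 : (n : ℝ) * p * (1 / p * maxDeviation μ 𝒜 x) = n * maxDeviation μ 𝒜 x := by field_simp
  have e2 : (n : ℝ) * p * (2 * relRademacher μ 𝒜 n + 2 / (3 * n * p) * L + 2 * s) =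
      2 * (n * p * relRademacher μ 𝒜 n) + 2 * L / 3 + n * p * (2 * s) := by field_simp
  rw [e1, e2] at h1
  -- The Bernstein bound only costs `L / 3` here, against the `2 * L / 3` available.
  have e3 : (n : ℝ) * p * (2 * s + s ^ 2 / 3) = n * p * (2 * s) + L / 3 := by
    rw [mul_add, ← hexp]
    ring
  rw [e3]
  linarith

theorem relRademacher_le (h𝒜 : IsMeasurableClass μ 𝒜) {V : ℕ} (hV : vcDimension 𝒜 ≤ V)
    (hV1 : 1 ≤ V) {n : ℕ} (hn : 1 ≤ n) (hp : 0 < unionProb μ 𝒜) :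
    relRademacher μ 𝒜 n ≤ 10 * √(V / (n * unionProb μ 𝒜)) := by
  set p := unionProb μ 𝒜 with hpdef
  have hn' : (0 : ℝ) < n := by exact_mod_cast hn
  have hV' : (0 : ℝ) < V := by exact_mod_cast hV1
  set Q : Measure (Fin n → E) := Measure.pi fun _ => μ
  set a : ℝ := √(V * (n * p)) with ha
  have ha0 : 0 < a := Real.sqrt_pos.2 (by positivity)
  have haa : a * a = V * (n * p) := Real.mul_self_sqrt (by positivity)
  have hUm := aemeasurable_ind_sUnion h𝒜
  have hint : ∀ s : Fin n → Bool, Integrable (supSum μ 𝒜 0 fun i => boolSign (s i)) Q :=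
    fun s => integrable_supSum h𝒜 0 _
  have hcount : ∀ i, Integrable (fun x : Fin n → E => ind (⋃₀ 𝒜) (x i)) Q := fun i =>
    (measurePreserving_eval (fun _ : Fin n => μ) i).integrable_comp_of_integrable
      (integrable_ind hUm)
  have hNi : Integrable (fun x : Fin n → E => ∑ i, ind (⋃₀ 𝒜) (x i)) Q :=
    integrable_finsetSum _ fun i _ => hcount i
  have hswap : (signAvg fun s : Fin n → Bool => ∫ x, supSum μ 𝒜 0 (fun i => boolSign (s i)) x ∂Q) =
      ∫ x, signAvg (fun s => supSum μ 𝒜 0 (fun i => boolSign (s i)) x) ∂Q := by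
    simp only [signAvg]
    rw [integral_const_mul, integral_finsetSum _ fun s _ => hint s]
  -- The inequality `2 * √(V * N) ≤ (V / a) * N + a` linearizes the root; with `a = √(V * n * p)`
  -- both terms have mean `a`, because `N` has mean `n * p`.
  have hpt : ∀ x : Fin n → E, signAvg (fun s => supSum μ 𝒜 0 (fun i => boolSign (s i)) x) ≤
      5 * (V / a * ∑ i, ind (⋃₀ 𝒜) (x i) + a) := by
    intro x
    have h1 := signAvg_iSup_ind_le hV hV1 x
    simp only [supSum, zero_mul, zero_add]
    refine h1.trans ?_
    set N := ∑ i, ind (⋃₀ 𝒜) (x i) with hN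
    have hN0 : 0 ≤ N := Finset.sum_nonneg fun i _ => ind_nonneg _ _
    set y := √(V * N) with hy
    have hyy : y ^ 2 = V * N := Real.sq_sqrt (by positivity)
    have h2 : V / a * N + a - 2 * y = (y - a) ^ 2 / a := by
      rw [div_mul_eq_mul_div, ← hyy]
      field_simp
      ring
    have h3 : 0 ≤ (y - a) ^ 2 / a := by positivity
    linarith
  have hi1 : Integrable (fun x => signAvg (fun s : Fin n → Bool =>
      supSum μ 𝒜 0 (fun i => boolSign (s i)) x)) Q := by
    simp only [signAvg]
    exact (integrable_finsetSum _ fun s _ => hint s).const_mul _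
  have hi2 : Integrable (fun x : Fin n → E => V / a * ∑ i, ind (⋃₀ 𝒜) (x i)) Q := hNi.const_mul _
  have hle := integral_mono hi1 ((hi2.add (integrable_const a)).const_mul 5) hpt
  simp only [Pi.add_apply] at hle
  rw [integral_const_mul, integral_add hi2 (integrable_const a), integral_const_mul,
    integral_finsetSum _ fun i _ => hcount i] at hle
  simp only [Q, integral_comp_eval_pi hUm.aestronglyMeasurable, integral_ind_sUnion h𝒜] at hle
  simp only [integral_const, probReal_univ, smul_eq_mul, one_mul, Finset.sum_const,
    Finset.card_univ, Fintype.card_fin, nsmul_eq_mul, ← hpdef] at hle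
  have e1 : (V : ℝ) / a * (n * p) = a := by
    rw [div_mul_eq_mul_div, ← haa]
    field_simp
  rw [e1] at hle
  rw [relRademacher_eq h𝒜, ← hpdef, hswap]
  have h5 : 1 / ((n : ℝ) * p) * ∫ x, signAvg (fun s : Fin n → Bool =>
      supSum μ 𝒜 0 (fun i => boolSign (s i)) x) ∂Q ≤ 1 / (n * p) * (5 * (a + a)) := by gcongr
  refine h5.trans (le_of_eq ?_)
  have e2 : √((V : ℝ) / (n * p)) = a / (n * p) := by
    rw [show (V : ℝ) / (n * p) = V * (n * p) / (n * p) ^ 2 by field_simp,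
      Real.sqrt_div (by positivity), Real.sqrt_sq (by positivity)]
  rw [e2]
  ring

end Deviation

/-! ### Transfer to an i.i.d. sample, and the final constants -/

/-- Uses only monotonicity and subadditivity of the outer measure, so neither the event `S` nor the
exceptional set `B` has to be measurable. -/
theorem one_sub_le_measureReal_of_map {Ω α : Type*} [MeasurableSpace Ω] [MeasurableSpace α]
    {P : Measure Ω} [IsProbabilityMeasure P] {Y : Ω → α} (hY : AEMeasurable Y P) {δ : ℝ}
    {B : Set α} (hB : (P.map Y).real B ≤ δ) {S : Set Ω} (h : ∀ ω, Y ω ∉ B → ω ∈ S) :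
    1 - δ ≤ P.real S := by
  have := Measure.isProbabilityMeasure_map hY
  have h1 : P.real (Y ⁻¹' B) ≤ (P.map Y).real B :=
    ENNReal.toReal_mono (measure_ne_top _ _) (Measure.le_map_apply hY B)
  have h2 : P.real Set.univ ≤ P.real (S ∪ Y ⁻¹' B) := measureReal_mono fun ω _ => by
    by_cases hω : Y ω ∈ B
    · exact Or.inr hω
    · exact Or.inl (h ω hω)
  rw [probReal_univ] at h2
  have h3 := measureReal_union_le (μ := P) S (Y ⁻¹' B)
  linarith

theorem map_eq_pi_of_hasLaw {Ω E : Type*} [MeasurableSpace Ω] [MeasurableSpace E] {μ : Measure E}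
    {P : Measure Ω} [IsProbabilityMeasure P] {n : ℕ} {X : Fin n → Ω → E}
    (hX : ∀ i, HasLaw (X i) μ P) (hind : iIndepFun X P) :
    P.map (fun ω i => X i ω) = Measure.pi fun _ => μ := by
  rw [(iIndepFun_iff_map_fun_eq_pi_map fun i => (hX i).aemeasurable).1 hind]
  congr 1
  funext i
  exact (hX i).map_eq

theorem ae_maxDeviation_eq_zero {Ω E : Type*} [MeasurableSpace Ω] [MeasurableSpace E]
    {μ : Measure E} [IsProbabilityMeasure μ] {P : Measure Ω} {𝒜 : Set (Set E)} {n : ℕ}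
    {X : Fin n → Ω → E} (hX : ∀ i, HasLaw (X i) μ P) (h0 : unionProb μ 𝒜 = 0) :
    ∀ᵐ ω ∂P, maxDeviation μ 𝒜 (fun i => X i ω) = 0 := by
  have hμ : μ (⋃₀ 𝒜) = 0 := (measureReal_eq_zero_iff).1 h0
  have hae : ∀ᵐ a ∂μ, a ∉ ⋃₀ 𝒜 := measure_eq_zero_iff_ae_notMem.1 hμ
  have hX' : ∀ i, ∀ᵐ ω ∂P, X i ω ∉ ⋃₀ 𝒜 := fun i => by
    refine ae_of_ae_map (p := fun a => a ∉ ⋃₀ 𝒜) (hX i).aemeasurable ?_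
    rw [(hX i).map_eq]
    exact hae
  filter_upwards [ae_all_iff.2 hX'] with ω hω
  have h : ∀ A : 𝒜, |μ.real (A : Set E) - 1 / (n : ℝ) * ∑ i, ind A.1 (X i ω)| = 0 := by
    intro A
    have h1 : μ.real A.1 = 0 :=
      (measureReal_eq_zero_iff).2 (measure_mono_null (Set.subset_sUnion_of_mem A.2) hμ)
    have h2 : ∀ i, ind A.1 (X i ω) = 0 := fun i =>
      ind_of_notMem fun hi => hω i (Set.subset_sUnion_of_mem A.2 hi)
    simp [h1, h2]
  simp only [maxDeviation, h, Real.iSup_const_zero]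

theorem two_thirds_mul_add_two_mul_sqrt_le {t : ℝ} (ht0 : 0 ≤ t) (ht1 : t ≤ 1) :
    2 / 3 * t + 2 * √t ≤ 3 * √t := by
  have h1 : t ≤ √t := by
    conv_lhs => rw [← Real.mul_self_sqrt ht0]
    exact mul_le_of_le_one_right (Real.sqrt_nonneg t) (Real.sqrt_le_one.2 ht1)
  linarith [Real.sqrt_nonneg t]

theorem mainTheorem2 :
    ∃ (K : ℝ) (C : ℝ → ℝ),
      ∀ (d : ℕ) (μ : Measure (EuclideanSpace ℝ (Fin d))) (_ : IsProbabilityMeasure μ)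
        (𝒜 : Set (Set (EuclideanSpace ℝ (Fin d)))) (_ : IsMeasurableClass μ 𝒜)
        (V : ℕ) (_ : vcDimension 𝒜 = (V : ℕ∞))
        (n : ℕ) (_ : 1 ≤ n)
        (Ω : Type*) (_ : MeasurableSpace Ω) (P : Measure Ω) (_ : IsProbabilityMeasure P)
        (X : Fin n → Ω → EuclideanSpace ℝ (Fin d))
        (_ : ∀ i, HasLaw (X i) μ P) (_ : iIndepFun X P)
        (p : ℝ) (_ : p = unionProb μ 𝒜),
        -- the bounds through the relative Rademacher average
        (∀ δ : ℝ, 0 < δ → δ < 1 → 0 < p →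
          1 - δ ≤ P.real {ω | 1 / p * maxDeviation μ 𝒜 (fun i => X i ω) ≤
            2 * relRademacher μ 𝒜 n + 2 / (3 * n * p) * Real.log (1 / δ)
              + 2 * √(1 / (n * p) * Real.log (1 / δ))} ∧
          (Real.exp (-(n * p)) ≤ δ →
            1 - δ ≤ P.real {ω | 1 / p * maxDeviation μ 𝒜 (fun i => X i ω) ≤
              2 * relRademacher μ 𝒜 n + 3 * √(1 / (n * p) * Real.log (1 / δ))})) ∧
        -- the order of the relative Rademacher average
        (1 ≤ V → 0 < p → relRademacher μ 𝒜 n ≤ K * √(V / (n * p))) ∧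
        -- the bounds through the VC dimension
        (1 ≤ V → ∀ δ₀ : ℝ, 0 < δ₀ → δ₀ < 1 → ∀ δ : ℝ, 0 < δ → δ ≤ δ₀ →
          1 - δ ≤ P.real {ω | maxDeviation μ 𝒜 (fun i => X i ω) ≤
            C δ₀ * (√p * √(V / n * Real.log (1 / δ)) + 1 / n * Real.log (1 / δ))} ∧
          (Real.exp (-(n * p)) ≤ δ →
            1 - δ ≤ P.real {ω | 1 / p * maxDeviation μ 𝒜 (fun i => X i ω) ≤
              C δ₀ * √(V / (n * p) * Real.log (1 / δ))})) := by
  -- The `20` is twice the Rademacher constant `10`, divided by `√(log (1 / δ₀)) ≤ √(log (1 / δ))`;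
  -- the `3` covers the deviation terms.
  refine ⟨10, fun δ₀ => 20 / √(Real.log (1 / δ₀)) + 3, ?_⟩
  intro d μ hμ 𝒜 h𝒜 V hV n hn Ω _ P hP X hX hind p hp
  have hmap := map_eq_pi_of_hasLaw hX hind
  have hXm : AEMeasurable (fun ω i => X i ω) P := aemeasurable_pi_lambda _ fun i => (hX i).aemeasurable
  have hn' : (0 : ℝ) < n := by exact_mod_cast hn
  have hlogpos : ∀ δ : ℝ, 0 < δ → δ < 1 → 0 < Real.log (1 / δ) := fun δ h0 h1 =>
    Real.log_pos (by rw [lt_div_iff₀ h0]; linarith)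
  have hlogle : ∀ δ : ℝ, 0 < δ → Real.exp (-(n * p)) ≤ δ → Real.log (1 / δ) ≤ n * p := by
    intro δ h0 h
    have := Real.log_le_log (Real.exp_pos _) h
    rw [Real.log_exp] at this
    rw [one_div, Real.log_inv]
    linarith
  have key : ∀ δ : ℝ, 0 < δ → δ < 1 → 0 < p → ∀ S : Set Ω,
      (∀ ω, 1 / p * maxDeviation μ 𝒜 (fun i => X i ω) ≤
            2 * relRademacher μ 𝒜 n + 2 / (3 * n * p) * Real.log (1 / δ)
              + 2 * √(1 / (n * p) * Real.log (1 / δ)) → ω ∈ S) → 1 - δ ≤ P.real S := by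
    intro δ h0 h1 hp0 S hS
    have ht := measureReal_maxDeviation_gt_le h𝒜 hn (hp ▸ hp0) (hlogpos δ h0 h1)
    rw [← hp, one_div δ, Real.log_inv, neg_neg, Real.exp_log h0, ← Real.log_inv, ← one_div δ,
      ← hmap] at ht
    exact one_sub_le_measureReal_of_map hXm ht fun ω hω => hS ω (not_lt.1 hω)
  have hsmall : ∀ δ : ℝ, 0 < δ → δ < 1 → 0 < p → Real.exp (-(n * p)) ≤ δ →
      2 / (3 * n * p) * Real.log (1 / δ) + 2 * √(1 / (n * p) * Real.log (1 / δ)) ≤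
        3 * √(1 / (n * p) * Real.log (1 / δ)) := by
    intro δ h0 h1 hp0 hδ
    have hnp : 0 < (n : ℝ) * p := by positivity
    have hL := hlogpos δ h0 h1
    have h := two_thirds_mul_add_two_mul_sqrt_le (t := 1 / (n * p) * Real.log (1 / δ))
      (by positivity) (by
        rw [one_div_mul_eq_div, div_le_one hnp]
        exact hlogle δ h0 hδ)
    refine le_trans (le_of_eq ?_) h
    congr 1
    field_simp
  refine ⟨fun δ h0 h1 hp0 => ⟨key δ h0 h1 hp0 _ fun ω h => h, fun hδ => ?_⟩,
    fun hV1 hp0 => hp ▸ relRademacher_le h𝒜 hV.le hV1 hn (hp ▸ hp0), ?_⟩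
  · refine key δ h0 h1 hp0 _ fun ω h => ?_
    have := hsmall δ h0 h1 hp0 hδ
    rw [Set.mem_ofPred_eq]
    linarith
  intro hV1 δ₀ h00 h01 δ h0 hδ₀
  have hV1' : (1 : ℝ) ≤ V := by exact_mod_cast hV1
  have h1 : δ < 1 := hδ₀.trans_lt h01
  set L := Real.log (1 / δ) with hL
  set r := √(Real.log (1 / δ₀)) with hr
  have hL0 : 0 < L := hlogpos δ h0 h1
  have hr0 : 0 < r := Real.sqrt_pos.2 (hlogpos δ₀ h00 h01)
  have hrL : r ≤ √L := Real.sqrt_le_sqrt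
    (Real.log_le_log (by positivity) (one_div_le_one_div_of_le h0 hδ₀))
  have hpnn : 0 ≤ p := hp ▸ measureReal_nonneg
  rcases hpnn.eq_or_lt with hp0 | hp0
  · constructor
    · have hae := ae_maxDeviation_eq_zero hX (hp.symm.trans hp0.symm)
      have h2 : P.real {ω | maxDeviation μ 𝒜 (fun i => X i ω) ≤
          (20 / r + 3) * (√p * √(V / n * L) + 1 / n * L)} = 1 := by
        rw [measureReal_def, measure_congr (Filter.eventuallyEq_univ.2 (hae.mono fun ω hω => ?_)),
          measure_univ, ENNReal.toReal_one]
        rw [hω]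
        positivity
      rw [h2]
      linarith
    -- For `p = 0` the condition would read `1 ≤ δ`, contradicting `δ ≤ δ₀ < 1`.
    · intro hδ
      rw [← hp0, mul_zero, neg_zero, Real.exp_zero] at hδ
      linarith
  have hR : relRademacher μ 𝒜 n ≤ 10 * √(V / (n * p)) :=
    hp ▸ relRademacher_le h𝒜 hV.le hV1 hn (hp ▸ hp0)
  have hA : √(V / (n * p)) ≤ 1 / r * √(V / (n * p) * L) := by
    rw [Real.sqrt_mul (by positivity), one_div_mul_eq_div, le_div_iff₀ hr0]
    exact mul_le_mul_of_nonneg_left hrL (Real.sqrt_nonneg _)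
  have hB : √(1 / (n * p) * L) ≤ √(V / (n * p) * L) := by gcongr
  constructor
  · refine key δ h0 h1 hp0 _ fun ω h => ?_
    rw [Set.mem_ofPred_eq]
    have h2 : 1 / p * maxDeviation μ 𝒜 (fun i => X i ω) ≤
        (20 / r + 2) * √(V / (n * p) * L) + 2 / (3 * n * p) * L := by
      have e : (20 / r + 2) * √(V / (n * p) * L) =
        20 * (1 / r * √(V / (n * p) * L)) + 2 * √(V / (n * p) * L) := by ring
      linarith
    have h3 := mul_le_mul_of_nonneg_left h2 hp0.le
    have e1 : p * (1 / p * maxDeviation μ 𝒜 (fun i => X i ω)) =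
        maxDeviation μ 𝒜 (fun i => X i ω) := by field_simp
    have e2 : p * √(V / (n * p) * L) = √p * √(V / n * L) := by
      rw [← Real.sqrt_mul hp0.le, show p * (V / n * L) = p ^ 2 * (V / (n * p) * L) by field_simp,
        Real.sqrt_mul (sq_nonneg p), Real.sqrt_sq hp0.le]
    have e3 : p * ((20 / r + 2) * √(V / (n * p) * L) + 2 / (3 * n * p) * L) =
        (20 / r + 2) * (√p * √(V / n * L)) + 2 / 3 * (1 / n * L) := by
      rw [← e2]
      field_simp
    rw [e1, e3] at h3
    refine h3.trans ?_
    have h4 : 0 ≤ √p * √(V / n * L) := by positivity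
    have h5 : 0 ≤ 1 / (n : ℝ) * L := by positivity
    have h6 : 0 ≤ 20 / r * (1 / (n : ℝ) * L) := by positivity
    linarith
  · intro hδ
    refine key δ h0 h1 hp0 _ fun ω h => ?_
    rw [Set.mem_ofPred_eq]
    have h2 := hsmall δ h0 h1 hp0 hδ
    have e : (20 / r + 3) * √(V / (n * p) * L) =
      20 * (1 / r * √(V / (n * p) * L)) + 3 * √(V / (n * p) * L) := by ring
    linarith
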